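/- Let $A$ be an associative algebra over $\mathbb C$ with involution, possibly without identity, whose product is non-degenerate, and let $(A,\Delta)$ be a multiplier Hopf $^*$-algebra, that is, $\Delta:A\to M(A\otimes A)$ is a coassociative non-degenerate $^*$-homomorphism such that the maps $a\otimes a'\mapsto\Delta(a)(1\otimes a')$ and $a\otimes a'\mapsto(a\otimes 1)\Delta(a')$ are linear bijections of $A\otimes A$ onto $A\otimes A$. Let $\varepsilon$ and $S$ be its counit and antipode, and let $\varphi$ be a positive left integral on $A$: a non-zero linear functional with $(\iota\otimes\varphi)((a'\otimes1)\Delta(a))=\varphi(a)a'$ and $\varphi(a^*a)\ge 0$ for all $a,a'\in A$. Let $B=\{\varphi(\,\cdot\,a):a\in A\}$ be the dual of $A$, write $\langle a,b\rangle$ for the value of $b\in B$ in $a\in A$, and let $F:A\to B$, $F(a)=\varphi(\,\cdot\,a)$, be the Fourier transform. The product, the involution and the comultiplication of $B$ are given by $\langle a,bb'\rangle=(b\otimes b')(\Delta(a))$, $\langle a,b^*\rangle=\overline{\langle S(a)^*,b\rangle}$ and $\langle a\otimes a',\Delta(b)\rangle=\langle a'a,b\rangle$ (the opposite of the coproduct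 dual to the product of $A$), and the integral $\varphi$ on $B$ is given by $\varphi(F(a))=\varepsilon(a)$. These objects are well defined: $\varepsilon$ and $S$ exist, $F$ is injective, and $B$ is closed under the product and the involution. Let $\mathcal H$ be the Hilbert space obtained by completing $A$ for the scalar product $(x',x)\mapsto\varphi(x^*x')$, with canonical map $\eta:A\to\mathcal H$, and let $\hat{\mathcal H}$ be the Hilbert space obtained by completing $B$ for $(y',y)\mapsto\varphi(y^*y')$ (this is again a positive scalar product), with canonical map $\hat\eta:B\to\hat{\mathcal H}$. For $a\in A$ and $b\in B$ there are bounded operators $\pi(a)$, $\lambda(b)$ on $\mathcal H$ and $\lambda(a)$, $\pi(b)$ on $\hat{\mathcal H}$ such that, for all $x\in A$ and $y\in B$ (in Sweedler notation, where the elements $\langle S^{-1}(x_{(1)}),b\rangle x_{(2)}$ and $\langle a,y_{(1)}\rangle y_{(2)}$ lie in $A$ and $B$ respectively), $$\pi(a)\eta(x)=\eta(ax),\qquad \lambda(b)\eta(x)=\langle S^{-1}(x_{(1)}),b\rangle\,\eta(x_{(2)}),$$ $$\lambda(a)\hat\eta(y)=\langle a,y_{(1)}\rangle\,\hat\eta(y_{(2)}),\qquad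 \pi(b)\hat\eta(y)=\hat\eta(by).$$ **Proposition 4.3 (Fourier transform isometry).** The Fourier transform extends to a unitary (an isometry onto) $U:\mathcal H\to\hat{\mathcal H}$, i.e. $U\eta(x)=\hat\eta(F(x))$ for all $x\in A$, and it transforms the operators $\pi(a)$ and $\lambda(b)$ on $\mathcal H$ to $\lambda(a)$ and $\pi(b)$ on $\hat{\mathcal H}$ respectively: $U\pi(a)=\lambda(a)U$ and $U\lambda(b)=\pi(b)U$ for all $a\in A$ and $b\in B$. -/

import Mathlib

open scoped TensorProduct ComplexConjugate ComplexOrder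

noncomputable section

/-! ### The GNS Hilbert space of a positive semidefinite scalar product -/

section GNS

/-- `s` is a (positive semidefinite, Hermitian) scalar product on the complex vector space `V`,
conjugate linear in the first variable. -/
structure IsScalarProduct {V : Type*} [AddCommGroup V] [Module ℂ V] (s : V → V → ℂ) : Prop where
  conj_symm : ∀ x y, conj (s y x) = s x y
  nonneg : ∀ x, 0 ≤ s x x
  add_left : ∀ x y z, s (x + y) z = s x z + s y z
  smul_left : ∀ x y (r : ℂ), s (r • x) y = conj r * s x y

variable {V : Type*} [AddCommGroup V] [Module ℂ V] {s : V → V → ℂ}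

/-- Type synonym of `V`, carrying the seminorm that comes from the scalar product `s`. -/
def PreGNS (_hs : IsScalarProduct s) : Type _ := V

instance (hs : IsScalarProduct s) : AddCommGroup (PreGNS hs) := inferInstanceAs (AddCommGroup V)

instance (hs : IsScalarProduct s) : Module ℂ (PreGNS hs) := inferInstanceAs (Module ℂ V)

/-- The pre-inner product space structure on `V` with inner product `s`. -/
abbrev preGNSCore (hs : IsScalarProduct s) : PreInnerProductSpace.Core ℂ (PreGNS hs) where
  inner := s
  conj_inner_symm := hs.conj_symm
  re_inner_nonneg x := (Complex.nonneg_iff.mp (hs.nonneg x)).1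
  add_left := hs.add_left
  smul_left := hs.smul_left

instance (hs : IsScalarProduct s) : SeminormedAddCommGroup (PreGNS hs) :=
  InnerProductSpace.Core.toSeminormedAddCommGroup (c := preGNSCore hs)

instance (hs : IsScalarProduct s) : InnerProductSpace ℂ (PreGNS hs) :=
  InnerProductSpace.ofCore (preGNSCore hs)

/-- The Hilbert space obtained by completing `V` for the scalar product `s`. -/
abbrev GNS (hs : IsScalarProduct s) : Type _ := UniformSpace.Completion (PreGNS hs)

/-- The canonical map of `V` into its completion. -/
def gnsMap (hs : IsScalarProduct s) (x : V) : GNS hs :=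
  ((show PreGNS hs from x : PreGNS hs) : UniformSpace.Completion (PreGNS hs))

theorem inner_gnsMap (hs : IsScalarProduct s) (x y : V) :
    inner ℂ (gnsMap hs x) (gnsMap hs y) = s x y :=
  UniformSpace.Completion.inner_coe (𝕜 := ℂ) (E := PreGNS hs) x y

end GNS

/-! ### Multipliers -/

section Multiplier

variable (R : Type*) [NonUnitalRing R] [Module ℂ R] [IsScalarTower ℂ R R] [SMulCommClass ℂ R R]

/-- The multiplier algebra `M(R)` of an algebra `R` with non-degenerate product: a multiplier `m`
is a pair of linear maps, `x ↦ m x` and `x ↦ x m`, satisfying `x (m y) = (x m) y`. -/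
def Multiplier : Subalgebra ℂ (Module.End ℂ R × (Module.End ℂ R)ᵐᵒᵖ) where
  carrier := {m | ∀ x y : R, x * m.1 y = m.2.unop x * y}
  mul_mem' := by
    intro m n hm hn x y
    simp only [Prod.fst_mul, Module.End.mul_apply, Prod.snd_mul, MulOpposite.unop_mul]
    rw [hm, hn]
  add_mem' := by
    intro m n hm hn x y
    simp only [Prod.fst_add, LinearMap.add_apply, Prod.snd_add, MulOpposite.unop_add, mul_add,
      add_mul]
    rw [hm, hn]
  algebraMap_mem' := by
    intro r x y
    simp [Prod.algebraMap_apply, MulOpposite.algebraMap_apply, Module.algebraMap_end_apply,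
      smul_mul_assoc, mul_smul_comm]

variable {R}

namespace Multiplier

/-- `left m x` is the product `m x`. -/
def left (m : Multiplier R) : R →ₗ[ℂ] R := m.1.1

/-- `right m x` is the product `x m`. -/
def right (m : Multiplier R) : R →ₗ[ℂ] R := m.1.2.unop

/-- The canonical map of `R` into `M(R)`. -/
def coe (z : R) : Multiplier R :=
  ⟨(LinearMap.mulLeft ℂ z, MulOpposite.op (LinearMap.mulRight ℂ z)), fun x y => by
    simp [mul_assoc]⟩

/-- The involution of `M(R)`: `m⋆ x = (x⋆ m)⋆` and `x m⋆ = (m x⋆)⋆`. -/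
instance [StarRing R] [StarModule ℂ R] : Star (Multiplier R) where
  star m :=
    ⟨({ toFun := fun x => star (right m (star x))
        map_add' := by simp
        map_smul' := by simp },
      MulOpposite.op
      { toFun := fun x => star (left m (star x))
        map_add' := by simp
        map_smul' := by simp }), fun x y => by
      have h : star y * left m (star x) = right m (star y) * star x := m.2 (star y) (star x)
      have h' := congrArg star h
      simpa using h'.symm⟩

end Multiplier

end Multiplier

section TensorStar

variable {A : Type*} [NonUnitalRing A] [Module ℂ A] [IsScalarTower ℂ A A] [SMulCommClass ℂ A A]
  [StarRing A] [StarModule ℂ A]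

/-- `A ⊗ A` is a `*`-algebra, with `(a ⊗ a')⋆ = a⋆ ⊗ a'⋆`. -/
instance instStarRingTensor : StarRing (A ⊗[ℂ] A) where
  star_mul x y := by
    induction x with
    | zero => simp
    | add x x' hx hx' => simp [add_mul, mul_add, hx, hx']
    | tmul a b =>
      induction y with
      | zero => simp
      | add y y' hy hy' => simp [add_mul, mul_add, hy, hy']
      | tmul c d => simp [Algebra.TensorProduct.tmul_mul_tmul]
  star_add := star_add

end TensorStar

section Legs

variable {A : Type*} [NonUnitalRing A] [Module ℂ A] [IsScalarTower ℂ A A] [SMulCommClass ℂ A A]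

/-- The multiplier `1 ⊗ a` of `A ⊗ A`. -/
def oneTmul (a : A) : Multiplier (A ⊗[ℂ] A) :=
  ⟨((LinearMap.mulLeft ℂ a).lTensor A, MulOpposite.op ((LinearMap.mulRight ℂ a).lTensor A)), by
    intro x y
    induction x with
    | zero => simp
    | add x x' hx hx' => rw [add_mul, hx, hx', map_add, add_mul]
    | tmul p q =>
      induction y with
      | zero => simp
      | add y y' hy hy' => rw [map_add, mul_add, hy, hy', mul_add]
      | tmul r t => simp [Algebra.TensorProduct.tmul_mul_tmul, mul_assoc]⟩

/-- The multiplier `a ⊗ 1` of `A ⊗ A`. -/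
def tmulOne (a : A) : Multiplier (A ⊗[ℂ] A) :=
  ⟨((LinearMap.mulLeft ℂ a).rTensor A, MulOpposite.op ((LinearMap.mulRight ℂ a).rTensor A)), by
    intro x y
    induction x with
    | zero => simp
    | add x x' hx hx' => rw [add_mul, hx, hx', map_add, add_mul]
    | tmul p q =>
      induction y with
      | zero => simp
      | add y y' hy hy' => rw [map_add, mul_add, hy, hy', mul_add]
      | tmul r t => simp [Algebra.TensorProduct.tmul_mul_tmul, mul_assoc]⟩

/-- `(ω ⊗ ι) z`, an element of `A`. -/
def sliceLeft (ω : A →ₗ[ℂ] ℂ) : A ⊗[ℂ] A →ₗ[ℂ] A :=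
  (TensorProduct.lid ℂ A).toLinearMap ∘ₗ ω.rTensor A

/-- `(ι ⊗ ω) z`, an element of `A`. -/
def sliceRight (ω : A →ₗ[ℂ] ℂ) : A ⊗[ℂ] A →ₗ[ℂ] A :=
  (TensorProduct.rid ℂ A).toLinearMap ∘ₗ ω.lTensor A

/-- `(ω ⊗ ω') z`, a scalar. -/
def tensorFunctional (ω ω' : A →ₗ[ℂ] ℂ) : A ⊗[ℂ] A →ₗ[ℂ] ℂ :=
  (TensorProduct.lid ℂ ℂ).toLinearMap ∘ₗ TensorProduct.map ω ω'

end Legs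

/-! ### The Fourier transform and the dual space -/

section Fourier

variable {A : Type*} [NonUnitalRing A] [Module ℂ A] [IsScalarTower ℂ A A] [SMulCommClass ℂ A A]

/-- The functional `φ(· a)` on `A`. -/
def fourierFunctional (φ : A →ₗ[ℂ] ℂ) : A →ₗ[ℂ] (A →ₗ[ℂ] ℂ) :=
  (LinearMap.llcomp ℂ A A ℂ φ) ∘ₗ (LinearMap.mul ℂ A).flip

/-- The underlying space of the dual `B` of `A`: the functionals `φ(· a)` with `a` in `A`. The
evaluation of `b` in `a`, i.e. the pairing `⟨a, b⟩`, is `b.1 a`. -/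
def DualSpace (φ : A →ₗ[ℂ] ℂ) : Submodule ℂ (A →ₗ[ℂ] ℂ) := LinearMap.range (fourierFunctional φ)

/-- The Fourier transform `F : A → B`, `F(a) = φ(· a)`. -/
def fourierTransform (φ : A →ₗ[ℂ] ℂ) : A →ₗ[ℂ] DualSpace φ := (fourierFunctional φ).rangeRestrict

/-- The element `a` of `A` with `F(a) = b`. -/
def fourierInv (φ : A →ₗ[ℂ] ℂ) (b : DualSpace φ) : A := Classical.choose b.2

open Classical in
/-- The element of `B` given by the functional `ω` (and `0` if `ω` does not belong to `B`). -/
def toDual (φ ω : A →ₗ[ℂ] ℂ) : DualSpace φ := if h : ω ∈ DualSpace φ then ⟨ω, h⟩ else 0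

/-- The comultiplication `Δ(b)` of `B` is the opposite of the dual of the product of `A`. As
multipliers of `B ⊗ B` are determined by their pairing with `A ⊗ A`, we take `Δ(b)` to be the
functional `⟨a ⊗ a', Δ(b)⟩ = ⟨a' a, b⟩` on `A ⊗ A`. -/
def dualComul (φ : A →ₗ[ℂ] ℂ) (b : DualSpace φ) : A ⊗[ℂ] A →ₗ[ℂ] ℂ :=
  b.1 ∘ₗ LinearMap.mul' ℂ A ∘ₗ (TensorProduct.comm ℂ A A).toLinearMap

/-- The functional `a' ↦ ⟨a, y₍₁₎⟩ ⟨a', y₍₂₎⟩ = ⟨a ⊗ a', Δ(y)⟩`. -/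
def dualSlice (φ : A →ₗ[ℂ] ℂ) (a : A) (y : DualSpace φ) : A →ₗ[ℂ] ℂ :=
  dualComul φ y ∘ₗ TensorProduct.mk ℂ A A a

theorem dualSlice_mem (φ : A →ₗ[ℂ] ℂ) (a : A) (y : DualSpace φ) :
    dualSlice φ a y ∈ DualSpace φ := by
  obtain ⟨_, c, rfl⟩ := y
  refine ⟨a * c, ?_⟩
  ext a'
  simp [dualSlice, dualComul, fourierFunctional, mul_assoc]

/-- The action `λ` of `A` on `B`, `λ(a)y = ⟨a, y₍₁₎⟩ y₍₂₎`. -/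
def dualLam (φ : A →ₗ[ℂ] ℂ) (a : A) (y : DualSpace φ) : DualSpace φ :=
  ⟨dualSlice φ a y, dualSlice_mem φ a y⟩

end Fourier

/-- The scalar product `φ(x⋆ x')` on `A`. -/
def gnsForm {A : Type*} [NonUnitalRing A] [Module ℂ A] [StarRing A] (φ : A →ₗ[ℂ] ℂ)
    (x x' : A) : ℂ :=
  φ (star x * x')

/-! ### Multiplier Hopf `*`-algebras -/

/-- A multiplier Hopf `*`-algebra structure on the `*`-algebra `A`. The product is non-degenerate,
`Δ : A → M(A ⊗ A)` is a comultiplication, and the maps `a ⊗ a' ↦ Δ(a)(1 ⊗ a')` and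
`a ⊗ a' ↦ (a ⊗ 1)Δ(a')` are injective with range `A ⊗ A`, i.e. they are (via the canonical
injection of `A ⊗ A` in `M(A ⊗ A)`) linear bijections `T₁`, `T₂` of `A ⊗ A`. -/
structure MultiplierHopfStarAlgebra (A : Type*) [NonUnitalRing A] [Module ℂ A]
    [IsScalarTower ℂ A A] [SMulCommClass ℂ A A] [StarRing A] [StarModule ℂ A] where
  nondegenerate_left : ∀ a : A, (∀ b, a * b = 0) → a = 0
  nondegenerate_right : ∀ a : A, (∀ b, b * a = 0) → a = 0
  /-- the comultiplication -/
  Δ : A →⋆ₙₐ[ℂ] Multiplier (A ⊗[ℂ] A)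
  /-- `Δ(A)(A ⊗ A) = A ⊗ A` -/
  comul_nondegenerate :
    Submodule.span ℂ {w : A ⊗[ℂ] A | ∃ (a : A) (z : A ⊗[ℂ] A), w = Multiplier.left (Δ a) z} = ⊤
  /-- the map `a ⊗ a' ↦ Δ(a)(1 ⊗ a')` -/
  T₁ : A ⊗[ℂ] A ≃ₗ[ℂ] A ⊗[ℂ] A
  T₁_spec : ∀ a a' : A, Multiplier.coe (T₁ (a ⊗ₜ a')) = Δ a * oneTmul a'
  /-- the map `a ⊗ a' ↦ (a ⊗ 1)Δ(a')` -/
  T₂ : A ⊗[ℂ] A ≃ₗ[ℂ] A ⊗[ℂ] A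
  T₂_spec : ∀ a a' : A, Multiplier.coe (T₂ (a ⊗ₜ a')) = tmulOne a * Δ a'
  /-- coassociativity, in the covered form
  `(a ⊗ 1 ⊗ 1) (Δ ⊗ ι)(Δ(b)(1 ⊗ c)) = (ι ⊗ Δ)((a ⊗ 1)Δ(b)) (1 ⊗ 1 ⊗ c)` -/
  coassoc : ∀ a b c : A,
    TensorProduct.assoc ℂ A A A
        (T₂.toLinearMap.rTensor A ((TensorProduct.assoc ℂ A A A).symm (a ⊗ₜ T₁ (b ⊗ₜ c)))) =
      T₁.toLinearMap.lTensor A (TensorProduct.assoc ℂ A A A (T₂ (a ⊗ₜ b) ⊗ₜ c))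

namespace MultiplierHopfStarAlgebra

variable {A : Type*} [NonUnitalRing A] [Module ℂ A] [IsScalarTower ℂ A A] [SMulCommClass ℂ A A]
  [StarRing A] [StarModule ℂ A] (D : MultiplierHopfStarAlgebra A)

/-- `ε` is the counit: `(ε ⊗ ι)Δ(a) = a` and `(ι ⊗ ε)Δ(a) = a`. -/
def IsCounit (ε : A →ₗ[ℂ] ℂ) : Prop :=
  (∀ a b, sliceLeft ε (D.T₁ (a ⊗ₜ b)) = a * b) ∧ (∀ a b, sliceRight ε (D.T₂ (b ⊗ₜ a)) = b * a)

/-- The counit (it exists and is unique). -/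
def counit : A →ₗ[ℂ] ℂ := Classical.epsilon D.IsCounit

/-- `S` is the antipode, a linear bijection of `A` with `m(S ⊗ ι)Δ(a) = ε(a)1` and
`m(ι ⊗ S)Δ(a) = ε(a)1`. -/
def IsAntipode (S : A ≃ₗ[ℂ] A) : Prop :=
  (∀ a b, LinearMap.mul' ℂ A (S.toLinearMap.rTensor A (D.T₁ (a ⊗ₜ b))) = D.counit a • b) ∧
  (∀ a b, LinearMap.mul' ℂ A (S.toLinearMap.lTensor A (D.T₂ (b ⊗ₜ a))) = D.counit a • b)

/-- The antipode (it exists and is unique). -/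
def antipode : A ≃ₗ[ℂ] A :=
  @Classical.epsilon _ ⟨LinearEquiv.refl ℂ A⟩ D.IsAntipode

/-- `φ` is a left integral: a non-zero linear functional with
`(ι ⊗ φ)((a' ⊗ 1)Δ(a)) = φ(a)a'`. -/
def IsLeftIntegral (φ : A →ₗ[ℂ] ℂ) : Prop :=
  φ ≠ 0 ∧ ∀ a a', sliceRight φ (D.T₂ (a' ⊗ₜ a)) = φ a • a'

/-! ### The `*`-algebra structure of the dual -/

/-- The functional `a ↦ (b ⊗ b')Δ(a)`. If `b = φ(· c)` and `b' = φ(· d)`, this means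
`a ↦ (φ ⊗ φ)(Δ(a)(c ⊗ d))`. -/
def dualMulFunctional (φ : A →ₗ[ℂ] ℂ) (b b' : DualSpace φ) : A →ₗ[ℂ] ℂ where
  toFun a := tensorFunctional φ φ (Multiplier.left (D.Δ a) (fourierInv φ b ⊗ₜ fourierInv φ b'))
  map_add' := by simp [Multiplier.left]
  map_smul' := by simp [Multiplier.left]

/-- The product of `B`, dual to the comultiplication of `A`. -/
def dualMul (φ : A →ₗ[ℂ] ℂ) (b b' : DualSpace φ) : DualSpace φ :=
  toDual φ (D.dualMulFunctional φ b b')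

/-- The functional `a ↦ conj ⟨S(a)⋆, b⟩`. -/
def dualStarFunctional (φ : A →ₗ[ℂ] ℂ) (b : DualSpace φ) : A →ₗ[ℂ] ℂ where
  toFun a := conj (b.1 (star (D.antipode a)))
  map_add' := by simp
  map_smul' := by simp

/-- The involution of `B`, `⟨a, b⋆⟩ = conj ⟨S(a)⋆, b⟩`. -/
def dualStar (φ : A →ₗ[ℂ] ℂ) (b : DualSpace φ) : DualSpace φ := toDual φ (D.dualStarFunctional φ b)

/-- The left integral on `B` (for the opposite comultiplication), normalized with respect to `φ`:
it takes the value `ε(a)` in `φ(· a)`. -/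
def dualIntegral (φ : A →ₗ[ℂ] ℂ) (b : DualSpace φ) : ℂ := D.counit (fourierInv φ b)

/-- The scalar product `φ(y⋆ y')` on `B`. -/
def dualForm (φ : A →ₗ[ℂ] ℂ) (y y' : DualSpace φ) : ℂ :=
  D.dualIntegral φ (D.dualMul φ (D.dualStar φ y) y')

/-! ### The actions -/

/-- `z` is the element `⟨S⁻¹(x₍₁₎), b⟩ x₍₂₎` of `A`, that is, the slice by the functional
`b ∘ S⁻¹` of the first leg of `Δ(x)`; slices of `Δ(x)` are multipliers of `A`, so `z` is described
by its products with elements of `A`. -/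
def IsConvolution (φ : A →ₗ[ℂ] ℂ) (b : DualSpace φ) (x z : A) : Prop :=
  ∀ d, z * d = sliceLeft (b.1 ∘ₗ D.antipode.symm.toLinearMap) (D.T₁ (x ⊗ₜ d))

/-- The action `λ` of `B` on `A`, `λ(b)x = ⟨S⁻¹(x₍₁₎), b⟩ x₍₂₎`. -/
def lam (φ : A →ₗ[ℂ] ℂ) (b : DualSpace φ) (x : A) : A := Classical.epsilon (D.IsConvolution φ b x)

/-- The objects that are described above by their characteristic properties do have these
properties (so that no default value is involved): the counit and the antipode exist, the Fourier
transform is injective, `B` is closed under product and involution, and `λ(b)x` exists in `A`. -/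
structure DualWellDefined (φ : A →ₗ[ℂ] ℂ) : Prop where
  counit : D.IsCounit D.counit
  antipode : D.IsAntipode D.antipode
  fourier_injective : Function.Injective (fourierTransform φ)
  mul_mem : ∀ b b', D.dualMulFunctional φ b b' ∈ DualSpace φ
  star_mem : ∀ b, D.dualStarFunctional φ b ∈ DualSpace φ
  lam : ∀ b x, D.IsConvolution φ b x (D.lam φ b x)

end MultiplierHopfStarAlgebra

end

set_option linter.unusedSectionVars false

/-! ### Slices of tensors -/

section Slices

variable {A : Type*} [NonUnitalRing A] [Module ℂ A] [IsScalarTower ℂ A A] [SMulCommClass ℂ A A]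

/-! Everything rests on the bijection `T₃`, `c ⊗ a ↦ Δ(a)(c ⊗ 1)`, whose inverse is `c ⊗ a ↦
S⁻¹(a₍₁₎)c ⊗ a₍₂₎`.

Left invariance gives `(ω ⊗ φ)(Δ(x) T₃(z)) = φ(x (ω ⊗ ι)(z))`. Taking `z = T₃⁻¹(c ⊗ d)` and `ω = φ`
shows that `F(c)F(d)` is `F` of `(φ ⊗ ι)T₃⁻¹(c ⊗ d) = φ(S⁻¹(d₍₁₎)c) d₍₂₎ = λ(F(c))d`. Thus `F`
carries `λ(b)` to left multiplication by `b`; it carries left multiplication by `a` to `λ(a)` by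
associativity alone. Applying the counit to `λ(F(x)⋆)y` gives `⟨S⁻¹(y), F(x)⋆⟩ = conj φ(y⋆x) =
φ(x⋆y)`, so `F` is isometric and hence extends to a unitary.

Boundedness comes from the same map: left invariance makes `T₃` isometric for `φ ⊗ φ`. The operators
`π(a)` are sums of slices of `T₃`, and the operators `λ(b)` are sums of slices of `T₃⁻¹`, by vector
functionals of the scalar product. For `λ(b)` this requires `φ(· e)` to have the form `φ(r⋆ ·)`
(`exists_modular'`). The operators on the dual side are the conjugates by the unitary.

The objects themselves must also be shown to exist. Coassociativity yields the counit and then the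
antipode. Strong left invariance (`antipodeFun_convRight`) makes the antipode bijective and leads to
the faithfulness of `φ`. The right integral `φ ∘ S` then shows that the dual is closed under the
involution and that `φ(y ·)` belongs to it. -/

@[simp] theorem sliceLeft_tmul (ω : A →ₗ[ℂ] ℂ) (x y : A) :
    sliceLeft ω (x ⊗ₜ y) = ω x • y := by simp [sliceLeft]

@[simp] theorem sliceRight_tmul (ω : A →ₗ[ℂ] ℂ) (x y : A) :
    sliceRight ω (x ⊗ₜ y) = ω y • x := by simp [sliceRight]

@[simp] theorem tensorFunctional_tmul (ω ω' : A →ₗ[ℂ] ℂ) (x y : A) :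
    tensorFunctional ω ω' (x ⊗ₜ y) = ω x * ω' y := by simp [tensorFunctional]

theorem sliceLeft_rTensor (ω : A →ₗ[ℂ] ℂ) (f : A →ₗ[ℂ] A) (z : A ⊗[ℂ] A) :
    sliceLeft ω (f.rTensor A z) = sliceLeft (ω ∘ₗ f) z := by
  induction z with
  | zero => simp
  | add x y hx hy => simp [hx, hy]
  | tmul x y => simp

theorem sliceLeft_lTensor (ω : A →ₗ[ℂ] ℂ) (f : A →ₗ[ℂ] A) (z : A ⊗[ℂ] A) :
    sliceLeft ω (f.lTensor A z) = f (sliceLeft ω z) := by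
  induction z with
  | zero => simp
  | add x y hx hy => simp [hx, hy]
  | tmul x y => simp

theorem sliceRight_rTensor (ω : A →ₗ[ℂ] ℂ) (f : A →ₗ[ℂ] A) (z : A ⊗[ℂ] A) :
    sliceRight ω (f.rTensor A z) = f (sliceRight ω z) := by
  induction z with
  | zero => simp
  | add x y hx hy => simp [hx, hy]
  | tmul x y => simp

theorem sliceRight_lTensor (ω : A →ₗ[ℂ] ℂ) (f : A →ₗ[ℂ] A) (z : A ⊗[ℂ] A) :
    sliceRight ω (f.lTensor A z) = sliceRight (ω ∘ₗ f) z := by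
  induction z with
  | zero => simp
  | add x y hx hy => simp [hx, hy]
  | tmul x y => simp

theorem apply_sliceLeft (ω ω' : A →ₗ[ℂ] ℂ) (z : A ⊗[ℂ] A) :
    ω' (sliceLeft ω z) = tensorFunctional ω ω' z := by
  induction z with
  | zero => simp
  | add x y hx hy => simp [hx, hy]
  | tmul x y => simp

theorem apply_sliceRight (ω ω' : A →ₗ[ℂ] ℂ) (z : A ⊗[ℂ] A) :
    ω (sliceRight ω' z) = tensorFunctional ω ω' z := by
  induction z with
  | zero => simp
  | add x y hx hy => simp [hx, hy]
  | tmul x y => simp [mul_comm]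

/-- A tensor whose left slices all lie in a submodule `N` lies in `A ⊗ N`. -/
theorem exists_sum_of_sliceLeft_mem (N : Submodule ℂ A) (z : A ⊗[ℂ] A)
    (h : ∀ ω, sliceLeft ω z ∈ N) :
    ∃ (s : Finset A) (n : A → A), (∀ i, n i ∈ N) ∧ z = ∑ i ∈ s, i ⊗ₜ[ℂ] n i := by
  classical
  let b := Module.Basis.ofVectorSpace ℂ A
  obtain ⟨c, rfl⟩ := TensorProduct.eq_repr_basis_left b z
  -- The coefficient at a basis vector is the slice by the corresponding coordinate functional.
  have hc : ∀ i, c i ∈ N := fun i => by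
    have := h (b.coord i)
    rw [Finsupp.sum, map_sum] at this
    simp only [sliceLeft_tmul, Module.Basis.coord_apply, Module.Basis.repr_self,
      Finsupp.single_apply, ite_smul, one_smul, zero_smul, Finset.sum_ite_eq'] at this
    split_ifs at this with hi
    · exact this
    · rw [Finsupp.notMem_support_iff.mp hi]; exact N.zero_mem
  refine ⟨c.support.image b, fun a => if h : ∃ i, b i = a then c h.choose else 0, fun a => ?_, ?_⟩
  · dsimp only
    split_ifs with h
    · exact hc _
    · exact N.zero_mem
  · rw [Finset.sum_image (fun _ _ _ _ h => b.injective h)]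
    refine Finset.sum_congr rfl fun i _ => ?_
    have h : ∃ j, b j = b i := ⟨i, rfl⟩
    dsimp only
    rw [dif_pos h, b.injective h.choose_spec]

theorem eq_zero_of_sliceLeft (z : A ⊗[ℂ] A) (h : ∀ ω, sliceLeft ω z = 0) : z = 0 := by
  obtain ⟨s, n, hn, rfl⟩ := exists_sum_of_sliceLeft_mem ⊥ z (by simpa using h)
  exact Finset.sum_eq_zero fun i _ => by rw [(Submodule.mem_bot ℂ).mp (hn i), TensorProduct.tmul_zero]

theorem eq_of_forall_functional {x y : A} (h : ∀ ω : A →ₗ[ℂ] ℂ, ω x = ω y) : x = y := by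
  rw [← sub_eq_zero, ← Module.forall_dual_apply_eq_zero_iff ℂ]
  intro f
  rw [map_sub, h f, sub_self]

theorem eq_of_sliceLeft {z w : A ⊗[ℂ] A} (h : ∀ ω, sliceLeft ω z = sliceLeft ω w) : z = w :=
  sub_eq_zero.mp (eq_zero_of_sliceLeft _ fun ω => by rw [map_sub, h, sub_self])

theorem eq_of_sliceRight {z w : A ⊗[ℂ] A} (h : ∀ ω, sliceRight ω z = sliceRight ω w) : z = w :=
  eq_of_sliceLeft fun ω => eq_of_forall_functional fun ω' => by
    rw [apply_sliceLeft, apply_sliceLeft, ← apply_sliceRight, ← apply_sliceRight, h]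

theorem exists_functional_eq_one {x : A} (hx : x ≠ 0) : ∃ ω : A →ₗ[ℂ] ℂ, ω x = 1 := by
  by_contra! h
  refine hx ((Module.forall_dual_apply_eq_zero_iff ℂ x).mp fun f => ?_)
  by_contra hf
  exact h ((f x)⁻¹ • f) (by simp [hf])

theorem tmul_right_cancel {x y c : A} (hc : c ≠ 0) (h : x ⊗ₜ[ℂ] c = y ⊗ₜ[ℂ] c) : x = y := by
  obtain ⟨ω, hω⟩ := exists_functional_eq_one hc
  simpa [hω] using congrArg (sliceRight ω) h

/-- Slices of a spanning family of tensors by a non-zero functional span. -/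
theorem exists_sliceRight_eq {ω : A →ₗ[ℂ] ℂ} (hω : ω ≠ 0) (x : A) : ∃ z, sliceRight ω z = x := by
  obtain ⟨c, hc⟩ : ∃ c, ω c ≠ 0 := by
    by_contra! h
    exact hω (LinearMap.ext h)
  exact ⟨x ⊗ₜ ((ω c)⁻¹ • c), by simp [hc]⟩

theorem exists_sliceLeft_eq {ω : A →ₗ[ℂ] ℂ} (hω : ω ≠ 0) (x : A) : ∃ z, sliceLeft ω z = x := by
  obtain ⟨c, hc⟩ : ∃ c, ω c ≠ 0 := by
    by_contra! h
    exact hω (LinearMap.ext h)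
  exact ⟨((ω c)⁻¹ • c) ⊗ₜ x, by simp [hc]⟩

/-! ### Multiplication of the legs of a tensor -/

/-- `(a ⊗ 1) z` -/
noncomputable abbrev lmulFst (a : A) : A ⊗[ℂ] A →ₗ[ℂ] A ⊗[ℂ] A := (LinearMap.mulLeft ℂ a).rTensor A

/-- `(1 ⊗ a) z` -/
noncomputable abbrev lmulSnd (a : A) : A ⊗[ℂ] A →ₗ[ℂ] A ⊗[ℂ] A := (LinearMap.mulLeft ℂ a).lTensor A

/-- `z (a ⊗ 1)` -/
noncomputable abbrev rmulFst (a : A) : A ⊗[ℂ] A →ₗ[ℂ] A ⊗[ℂ] A := (LinearMap.mulRight ℂ a).rTensor A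

/-- `z (1 ⊗ a)` -/
noncomputable abbrev rmulSnd (a : A) : A ⊗[ℂ] A →ₗ[ℂ] A ⊗[ℂ] A := (LinearMap.mulRight ℂ a).lTensor A

theorem lTensor_rmulFst (f : A →ₗ[ℂ] A) (a : A) (z : A ⊗[ℂ] A) :
    f.lTensor A (rmulFst a z) = rmulFst a (f.lTensor A z) := by
  induction z with
  | zero => simp
  | add x y hx hy => simp only [map_add, hx, hy]
  | tmul x y => simp

theorem lTensor_lmulFst (f : A →ₗ[ℂ] A) (a : A) (z : A ⊗[ℂ] A) :
    f.lTensor A (lmulFst a z) = lmulFst a (f.lTensor A z) := by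
  induction z with
  | zero => simp
  | add x y hx hy => simp only [map_add, hx, hy]
  | tmul x y => simp

theorem mul'_rmulSnd (a : A) (z : A ⊗[ℂ] A) :
    LinearMap.mul' ℂ A (rmulSnd a z) = LinearMap.mul' ℂ A z * a := by
  induction z with
  | zero => simp
  | add x y hx hy => simp only [map_add, hx, hy, add_mul]
  | tmul x y => simp [mul_assoc]

theorem mul'_lmulFst (a : A) (z : A ⊗[ℂ] A) :
    LinearMap.mul' ℂ A (lmulFst a z) = a * LinearMap.mul' ℂ A z := by
  induction z with
  | zero => simp
  | add x y hx hy => simp only [map_add, hx, hy, mul_add]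
  | tmul x y => simp [mul_assoc]

end Slices

section StarSlices

variable {A : Type*} [NonUnitalRing A] [Module ℂ A] [IsScalarTower ℂ A A] [SMulCommClass ℂ A A]
  [StarRing A] [StarModule ℂ A]

theorem sliceRight_star {ω : A →ₗ[ℂ] ℂ} (hω : ∀ x, ω (star x) = conj (ω x)) (z : A ⊗[ℂ] A) :
    sliceRight ω (star z) = star (sliceRight ω z) := by
  induction z with
  | zero => simp
  | add x y hx hy => simp [hx, hy]
  | tmul x y => simp [hω]

end StarSlices

/-! ### Multipliers of a tensor product -/

namespace Multiplier

section

variable {R : Type*} [NonUnitalRing R] [Module ℂ R] [IsScalarTower ℂ R R] [SMulCommClass ℂ R R]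

theorem mul_left_eq (m : Multiplier R) (x y : R) : x * left m y = right m x * y := m.2 x y

theorem left_mul (m n : Multiplier R) (x : R) : left (m * n) x = left m (left n x) := rfl

theorem right_mul (m n : Multiplier R) (x : R) : right (m * n) x = right n (right m x) := rfl

theorem left_coe (z x : R) : left (coe z) x = z * x := rfl

theorem right_coe (z x : R) : right (coe z) x = x * z := rfl

theorem ext_right (hR : ∀ x : R, (∀ y, y * x = 0) → x = 0) {m n : Multiplier R}
    (h : ∀ x, right m x = right n x) : m = n := by
  refine Subtype.ext (Prod.ext (LinearMap.ext fun x => ?_)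
    (MulOpposite.unop_injective (LinearMap.ext h)))
  refine sub_eq_zero.mp (hR _ fun y => ?_)
  have h1 := mul_left_eq m y x
  have h2 := mul_left_eq n y x
  rw [mul_sub]
  change y * left m x - y * left n x = 0
  rw [h1, h2, h, sub_self]

theorem coe_injective (hR : ∀ x : R, (∀ y, y * x = 0) → x = 0) :
    Function.Injective (coe : R → Multiplier R) := fun x y h => by
  refine sub_eq_zero.mp (hR _ fun w => ?_)
  rw [mul_sub, ← right_coe, ← right_coe, h, sub_self]

theorem coe_left (hR : ∀ x : R, (∀ y, y * x = 0) → x = 0) (m : Multiplier R) (z : R) :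
    coe (left m z) = m * coe z :=
  ext_right hR fun x => mul_left_eq m x z

end

section

variable {R : Type*} [NonUnitalRing R] [Module ℂ R] [IsScalarTower ℂ R R] [SMulCommClass ℂ R R]
  [StarRing R] [StarModule ℂ R]

theorem left_star (m : Multiplier R) (x : R) : left (star m) x = star (right m (star x)) := rfl

theorem right_star (m : Multiplier R) (x : R) : right (star m) x = star (left m (star x)) := rfl

theorem star_mul' (m n : Multiplier R) : star (m * n) = star n * star m := by
  refine Subtype.ext (Prod.ext (LinearMap.ext fun x => ?_)
    (MulOpposite.unop_injective (LinearMap.ext fun x => ?_)))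
  · change left (star (m * n)) x = left (star n * star m) x
    simp [left_star, left_mul, right_mul]
  · change right (star (m * n)) x = right (star n * star m) x
    simp [right_star, left_mul, right_mul]

theorem coe_star (z : R) : coe (star z) = star (coe z) := by
  refine Subtype.ext (Prod.ext (LinearMap.ext fun x => ?_)
    (MulOpposite.unop_injective (LinearMap.ext fun x => ?_)))
  · change left (coe (star z)) x = left (star (coe z)) x
    simp [left_star, left_coe, right_coe]
  · change right (coe (star z)) x = right (star (coe z)) x
    simp [right_star, left_coe, right_coe]

end

end Multiplier

/-! ### The multipliers `a ⊗ 1` and `1 ⊗ a` -/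

section LegMultipliers

variable {A : Type*} [NonUnitalRing A] [Module ℂ A] [IsScalarTower ℂ A A] [SMulCommClass ℂ A A]

open Multiplier

theorem right_oneTmul (a : A) (z : A ⊗[ℂ] A) : right (oneTmul a) z = rmulSnd a z := rfl
theorem right_tmulOne (a : A) (z : A ⊗[ℂ] A) : right (tmulOne a) z = rmulFst a z := rfl

/-- Non-degeneracy is used one leg at a time: slicing the other leg by arbitrary functionals reduces
each cancellation to `A`. -/
theorem tensor_nondegenerate_right (hA : ∀ a : A, (∀ b, b * a = 0) → a = 0) (z : A ⊗[ℂ] A)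
    (hz : ∀ w, w * z = 0) : z = 0 := by
  have h1 : ∀ a, lmulFst a z = 0 := fun a => by
    refine eq_zero_of_sliceLeft _ fun ω => hA _ fun b => ?_
    have h : lmulSnd b (lmulFst a z) = (a ⊗ₜ b) * z := by
      clear hz
      induction z with
      | zero => simp
      | add x y hx hy => simp only [map_add, hx, hy, mul_add]
      | tmul x y => simp
    rw [hz] at h
    have := congrArg (sliceLeft ω) h
    simpa [sliceLeft_lTensor] using this
  refine eq_of_sliceRight fun ω => sub_eq_zero.mp (hA _ fun b => ?_)
  rw [map_zero, sub_zero]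
  have := congrArg (sliceRight ω) (h1 b)
  simpa [sliceRight_rTensor] using this

theorem coe_rmulSnd (hA : ∀ a : A, (∀ b, b * a = 0) → a = 0) (a : A) (z : A ⊗[ℂ] A) :
    coe (rmulSnd a z) = coe z * oneTmul a := by
  refine ext_right (tensor_nondegenerate_right hA) fun x => ?_
  rw [right_mul, right_coe, right_coe, right_oneTmul]
  induction x with
  | zero => simp
  | add x y hx hy => simp only [add_mul, map_add, hx, hy]
  | tmul x y =>
    induction z with
    | zero => simp
    | add z z' hx hy => simp only [mul_add, map_add, hx, hy]
    | tmul p q => simp [mul_assoc]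

theorem coe_rmulFst (hA : ∀ a : A, (∀ b, b * a = 0) → a = 0) (a : A) (z : A ⊗[ℂ] A) :
    coe (rmulFst a z) = coe z * tmulOne a := by
  refine ext_right (tensor_nondegenerate_right hA) fun x => ?_
  rw [right_mul, right_coe, right_coe, right_tmulOne]
  induction x with
  | zero => simp
  | add x y hx hy => simp only [add_mul, map_add, hx, hy]
  | tmul x y =>
    induction z with
    | zero => simp
    | add z z' hx hy => simp only [mul_add, map_add, hx, hy]
    | tmul p q => simp [mul_assoc]

theorem star_oneTmul {A : Type*} [NonUnitalRing A] [Module ℂ A] [IsScalarTower ℂ A A]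
    [SMulCommClass ℂ A A] [StarRing A] [StarModule ℂ A] (a : A) :
    star (oneTmul a) = oneTmul (star a) := by
  have h1 : ∀ z, star (rmulSnd a (star z)) = lmulSnd (star a) z := fun z => by
    induction z with
    | zero => simp
    | add x y hx hy => simp only [map_add, star_add, hx, hy]
    | tmul x y => simp
  have h2 : ∀ z, star (lmulSnd a (star z)) = rmulSnd (star a) z := fun z => by
    induction z with
    | zero => simp
    | add x y hx hy => simp only [map_add, star_add, hx, hy]
    | tmul x y => simp
  exact Subtype.ext (Prod.ext (LinearMap.ext h1) (MulOpposite.unop_injective (LinearMap.ext h2)))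

theorem star_tmulOne {A : Type*} [NonUnitalRing A] [Module ℂ A] [IsScalarTower ℂ A A]
    [SMulCommClass ℂ A A] [StarRing A] [StarModule ℂ A] (a : A) :
    star (tmulOne a) = tmulOne (star a) := by
  have h1 : ∀ z, star (rmulFst a (star z)) = lmulFst (star a) z := fun z => by
    induction z with
    | zero => simp
    | add x y hx hy => simp only [map_add, star_add, hx, hy]
    | tmul x y => simp
  have h2 : ∀ z, star (lmulFst a (star z)) = rmulFst (star a) z := fun z => by
    induction z with
    | zero => simp
    | add x y hx hy => simp only [map_add, star_add, hx, hy]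
    | tmul x y => simp
  exact Subtype.ext (Prod.ext (LinearMap.ext h1) (MulOpposite.unop_injective (LinearMap.ext h2)))

end LegMultipliers

/-- The map `z ↦ (T z⋆)⋆`. -/
noncomputable def starConj {V : Type*} [AddCommGroup V] [Module ℂ V] [StarAddMonoid V]
    [StarModule ℂ V] (T : V ≃ₗ[ℂ] V) : V ≃ₗ[ℂ] V where
  toFun z := star (T (star z))
  map_add' := by simp
  map_smul' := by simp
  invFun z := star (T.symm (star z))
  left_inv _ := by simp
  right_inv _ := by simp

theorem starConj_apply {V : Type*} [AddCommGroup V] [Module ℂ V] [StarAddMonoid V]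
    [StarModule ℂ V] (T : V ≃ₗ[ℂ] V) (z : V) : starConj T z = star (T (star z)) := rfl

theorem starConj_symm_apply {V : Type*} [AddCommGroup V] [Module ℂ V] [StarAddMonoid V]
    [StarModule ℂ V] (T : V ≃ₗ[ℂ] V) (z : V) :
    (starConj T).symm z = star (T.symm (star z)) := rfl

/-! ### The maps `T₁`, ..., `T₄` and their calculus inside `M(A ⊗ A)` -/

namespace MultiplierHopfStarAlgebra

open Multiplier

variable {A : Type*} [NonUnitalRing A] [Module ℂ A] [IsScalarTower ℂ A A] [SMulCommClass ℂ A A]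
  [StarRing A] [StarModule ℂ A] (D : MultiplierHopfStarAlgebra A)

/-- The map `a ⊗ a' ↦ Δ(a')(a ⊗ 1)`. -/
noncomputable def T₃ : A ⊗[ℂ] A ≃ₗ[ℂ] A ⊗[ℂ] A := starConj D.T₂

/-- The map `a ⊗ a' ↦ (1 ⊗ a')Δ(a)`. -/
noncomputable def T₄ : A ⊗[ℂ] A ≃ₗ[ℂ] A ⊗[ℂ] A := starConj D.T₁

theorem T₃_spec (a a' : A) : coe (D.T₃ (a ⊗ₜ a')) = D.Δ a' * tmulOne a := by
  rw [T₃, starConj_apply, coe_star, TensorProduct.star_tmul, D.T₂_spec, Multiplier.star_mul', star_tmulOne,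
    ← map_star D.Δ, star_star, star_star]

theorem T₄_spec (a a' : A) : coe (D.T₄ (a ⊗ₜ a')) = oneTmul a' * D.Δ a := by
  rw [T₄, starConj_apply, coe_star, TensorProduct.star_tmul, D.T₁_spec, Multiplier.star_mul', star_oneTmul,
    ← map_star D.Δ, star_star, star_star]

theorem tensor_nondeg (D : MultiplierHopfStarAlgebra A) (x : A ⊗[ℂ] A) (h : ∀ y, y * x = 0) : x = 0 :=
  tensor_nondegenerate_right D.nondegenerate_right x h

theorem coe_inj (D : MultiplierHopfStarAlgebra A) {x y : A ⊗[ℂ] A} (h : coe x = coe y) : x = y :=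
  coe_injective D.tensor_nondeg h

theorem coe_rmulSnd (D : MultiplierHopfStarAlgebra A) (a : A) (z : A ⊗[ℂ] A) : coe (rmulSnd a z) = coe z * oneTmul a :=
  _root_.coe_rmulSnd D.nondegenerate_right a z

theorem coe_rmulFst (D : MultiplierHopfStarAlgebra A) (a : A) (z : A ⊗[ℂ] A) : coe (rmulFst a z) = coe z * tmulOne a :=
  _root_.coe_rmulFst D.nondegenerate_right a z

theorem coe_lmulFst (D : MultiplierHopfStarAlgebra A) (a : A) (z : A ⊗[ℂ] A) : coe (lmulFst a z) = tmulOne a * coe z :=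
  coe_left D.tensor_nondeg (tmulOne a) z

theorem coe_lmulSnd (D : MultiplierHopfStarAlgebra A) (a : A) (z : A ⊗[ℂ] A) : coe (lmulSnd a z) = oneTmul a * coe z :=
  coe_left D.tensor_nondeg (oneTmul a) z

theorem coe_comul (a : A) (z : A ⊗[ℂ] A) : coe (left (D.Δ a) z) = D.Δ a * coe z :=
  coe_left D.tensor_nondeg (D.Δ a) z

theorem mul_cancel_left (D : MultiplierHopfStarAlgebra A) {x y : A} (h : ∀ d, d * x = d * y) : x = y :=
  sub_eq_zero.mp (D.nondegenerate_right _ fun d => by rw [mul_sub, h, sub_self])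

theorem mul_cancel_right (D : MultiplierHopfStarAlgebra A) {x y : A} (h : ∀ d, x * d = y * d) : x = y :=
  sub_eq_zero.mp (D.nondegenerate_left _ fun d => by rw [sub_mul, h, sub_self])

theorem lmulFst_cancel (D : MultiplierHopfStarAlgebra A) {x y : A ⊗[ℂ] A} (h : ∀ d, lmulFst d x = lmulFst d y) : x = y :=
  eq_of_sliceRight fun ω => D.mul_cancel_left fun d => by
    simpa [sliceRight_rTensor] using congrArg (sliceRight ω) (h d)

/-- Both sides are `(d ⊗ 1)Δ(a)(1 ⊗ c)`. Such doubly covered coproducts are the means of passing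
between the four maps. -/
theorem lmulFst_T₁ (d a c : A) : lmulFst d (D.T₁ (a ⊗ₜ c)) = rmulSnd c (D.T₂ (d ⊗ₜ a)) :=
  D.coe_inj (by rw [D.coe_lmulFst, D.coe_rmulSnd, D.T₁_spec, D.T₂_spec, mul_assoc])

theorem lmulFst_T₃ (d a c : A) : lmulFst d (D.T₃ (c ⊗ₜ a)) = rmulFst c (D.T₂ (d ⊗ₜ a)) :=
  D.coe_inj (by rw [D.coe_lmulFst, D.coe_rmulFst, D.T₃_spec, D.T₂_spec, mul_assoc])

theorem lmulSnd_T₁ (d a c : A) : lmulSnd d (D.T₁ (a ⊗ₜ c)) = rmulSnd c (D.T₄ (a ⊗ₜ d)) :=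
  D.coe_inj (by rw [D.coe_lmulSnd, D.coe_rmulSnd, D.T₁_spec, D.T₄_spec, mul_assoc])

theorem lmulSnd_T₃ (d a c : A) : lmulSnd d (D.T₃ (c ⊗ₜ a)) = rmulFst c (D.T₄ (a ⊗ₜ d)) :=
  D.coe_inj (by rw [D.coe_lmulSnd, D.coe_rmulFst, D.T₃_spec, D.T₄_spec, mul_assoc])

theorem oneTmul_mul (D : MultiplierHopfStarAlgebra A) (a b : A) : oneTmul (a * b) = oneTmul a * oneTmul b :=
  ext_right D.tensor_nondeg fun z => by
    rw [right_mul, right_oneTmul, right_oneTmul, right_oneTmul]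
    induction z with
    | zero => simp
    | add x y hx hy => simp only [map_add, hx, hy]
    | tmul x y => simp [mul_assoc]

theorem tmulOne_mul (D : MultiplierHopfStarAlgebra A) (a b : A) : tmulOne (a * b) = tmulOne a * tmulOne b :=
  ext_right D.tensor_nondeg fun z => by
    rw [right_mul, right_tmulOne, right_tmulOne, right_tmulOne]
    induction z with
    | zero => simp
    | add x y hx hy => simp only [map_add, hx, hy]
    | tmul x y => simp [mul_assoc]

theorem rmulSnd_T₁ (a b c : A) : rmulSnd c (D.T₁ (a ⊗ₜ b)) = D.T₁ (a ⊗ₜ (b * c)) :=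
  D.coe_inj (by rw [D.coe_rmulSnd, D.T₁_spec, D.T₁_spec, D.oneTmul_mul, mul_assoc])

theorem rmulFst_T₃ (a b c : A) : rmulFst c (D.T₃ (a ⊗ₜ b)) = D.T₃ ((a * c) ⊗ₜ b) :=
  D.coe_inj (by rw [D.coe_rmulFst, D.T₃_spec, D.T₃_spec, D.tmulOne_mul, mul_assoc])

theorem rmulSnd_T₃ (a c d : A) : rmulSnd c (D.T₃ (d ⊗ₜ a)) = left (D.Δ a) (d ⊗ₜ c) := by
  refine D.coe_inj ?_
  have h : coe (d ⊗ₜ[ℂ] c) = tmulOne d * oneTmul c := ext_right D.tensor_nondeg fun z => by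
    rw [right_mul, right_coe, right_oneTmul, right_tmulOne]
    induction z with
    | zero => simp
    | add x y hx hy => simp only [add_mul, map_add, hx, hy]
    | tmul x y => simp
  rw [D.coe_rmulSnd, D.T₃_spec, D.coe_comul, h, mul_assoc]

theorem rmulFst_T₁ (a c d : A) : rmulFst d (D.T₁ (a ⊗ₜ c)) = left (D.Δ a) (d ⊗ₜ c) := by
  refine D.coe_inj ?_
  have h : coe (d ⊗ₜ[ℂ] c) = oneTmul c * tmulOne d := ext_right D.tensor_nondeg fun z => by
    rw [right_mul, right_coe, right_oneTmul, right_tmulOne]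
    induction z with
    | zero => simp
    | add x y hx hy => simp only [add_mul, map_add, hx, hy]
    | tmul x y => simp
  rw [D.coe_rmulFst, D.T₁_spec, D.coe_comul, h, mul_assoc]

theorem comul_T₁ (a b c : A) : left (D.Δ a) (D.T₁ (b ⊗ₜ c)) = D.T₁ ((a * b) ⊗ₜ c) :=
  D.coe_inj (by rw [D.coe_comul, D.T₁_spec, D.T₁_spec, map_mul, mul_assoc])

theorem comul_T₃ (a b c : A) : left (D.Δ a) (D.T₃ (c ⊗ₜ b)) = D.T₃ (c ⊗ₜ (a * b)) :=
  D.coe_inj (by rw [D.coe_comul, D.T₃_spec, D.T₃_spec, map_mul, mul_assoc])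

theorem T₁_rmulSnd (c : A) (z : A ⊗[ℂ] A) : D.T₁ (rmulSnd c z) = rmulSnd c (D.T₁ z) := by
  induction z with
  | zero => simp
  | add x y hx hy => simp only [map_add, hx, hy]
  | tmul x y => rw [rmulSnd_T₁, LinearMap.lTensor_tmul, LinearMap.mulRight_apply]

theorem T₃_rmulFst (c : A) (z : A ⊗[ℂ] A) : D.T₃ (rmulFst c z) = rmulFst c (D.T₃ z) := by
  induction z with
  | zero => simp
  | add x y hx hy => simp only [map_add, hx, hy]
  | tmul x y => rw [rmulFst_T₃, LinearMap.rTensor_tmul, LinearMap.mulRight_apply]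

/-! ### Coassociativity -/

/-- The map `w ↦ (T₂ ⊗ ι)(a ⊗ w)` of `A ⊗ A` into `A ⊗ (A ⊗ A)`. -/
noncomputable def coact (a : A) : A ⊗[ℂ] A →ₗ[ℂ] A ⊗[ℂ] (A ⊗[ℂ] A) :=
  (TensorProduct.assoc ℂ A A A).toLinearMap ∘ₗ
    (D.T₂.toLinearMap ∘ₗ TensorProduct.mk ℂ A A a).rTensor A

theorem coact_tmul (a u v : A) :
    D.coact a (u ⊗ₜ v) = TensorProduct.assoc ℂ A A A (D.T₂ (a ⊗ₜ u) ⊗ₜ v) := by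
  simp [coact]

/-- This is the form in which coassociativity is used: `coact` intertwines `T₁` with `ι ⊗ T₁`, and
therefore also their inverses. -/
theorem coact_T₁ (a : A) (w : A ⊗[ℂ] A) :
    D.coact a (D.T₁ w) = D.T₁.toLinearMap.lTensor A (D.coact a w) := by
  have h : ∀ z : A ⊗[ℂ] A, D.coact a z = TensorProduct.assoc ℂ A A A
      (D.T₂.toLinearMap.rTensor A ((TensorProduct.assoc ℂ A A A).symm (a ⊗ₜ z))) := fun z => by
    induction z with
    | zero => simp
    | add x y hx hy => simp only [map_add, TensorProduct.tmul_add, hx, hy]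
    | tmul x y => simp [coact_tmul]
  induction w with
  | zero => simp
  | add x y hx hy => simp only [map_add, hx, hy]
  | tmul x y => rw [h, D.coassoc, coact_tmul]

theorem coact_T₁_symm (a : A) (w : A ⊗[ℂ] A) :
    D.coact a (D.T₁.symm w) = D.T₁.symm.toLinearMap.lTensor A (D.coact a w) := by
  obtain ⟨w, rfl⟩ := D.T₁.surjective w
  rw [coact_T₁, LinearEquiv.symm_apply_apply, ← LinearMap.comp_apply, ← LinearMap.lTensor_comp]
  simp

theorem lTensor_assoc_tmul {V : Type*} [AddCommGroup V] [Module ℂ V]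
    (k : A ⊗[ℂ] A →ₗ[ℂ] V) (z : A ⊗[ℂ] A) (v : A) :
    k.lTensor A (TensorProduct.assoc ℂ A A A (z ⊗ₜ v)) =
      (k ∘ₗ (TensorProduct.mk ℂ A A).flip v).lTensor A z := by
  induction z with
  | zero => simp
  | add x y hx hy => simp only [map_add, TensorProduct.add_tmul, hx, hy]
  | tmul x y => simp

theorem lTensor_mul'_coact (a : A) (w : A ⊗[ℂ] A) :
    (LinearMap.mul' ℂ A).lTensor A (D.coact a w) = lmulFst a (D.T₁ w) := by
  induction w with
  | zero => simp
  | add x y hx hy => simp only [map_add, hx, hy]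
  | tmul x y =>
    rw [coact_tmul, lTensor_assoc_tmul, lmulFst_T₁]
    congr 1

/-! ### The counit -/

/-- Multiplying the last two legs of `(a ⊗ 1)Δ(u) ⊗ v` gives `(a ⊗ 1)T₁(u ⊗ v)`. Since `coact`
commutes with `T₁⁻¹`, one may apply this to `T₁⁻¹(b ⊗ c)`. -/
theorem lTensor_mul_T₁_symm (a b c : A) :
    (LinearMap.mul' ℂ A ∘ₗ D.T₁.symm.toLinearMap ∘ₗ (TensorProduct.mk ℂ A A).flip c).lTensor A
      (D.T₂ (a ⊗ₜ b)) = (a * b) ⊗ₜ c := by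
  have h := D.lTensor_mul'_coact a (D.T₁.symm (b ⊗ₜ c))
  rw [coact_T₁_symm, LinearEquiv.apply_symm_apply, coact_tmul, ← LinearMap.comp_apply,
    ← LinearMap.lTensor_comp, lTensor_assoc_tmul] at h
  simpa [LinearMap.comp_assoc] using h

theorem lTensor_mul_T₁_symm' (c : A) (z : A ⊗[ℂ] A) :
    (LinearMap.mul' ℂ A ∘ₗ D.T₁.symm.toLinearMap ∘ₗ (TensorProduct.mk ℂ A A).flip c).lTensor A z =
      LinearMap.mul' ℂ A (D.T₂.symm z) ⊗ₜ c := by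
  obtain ⟨z, rfl⟩ := D.T₂.surjective z
  rw [LinearEquiv.symm_apply_apply]
  induction z with
  | zero => simp
  | add x y hx hy => simp only [map_add, TensorProduct.add_tmul, hx, hy]
  | tmul x y => rw [lTensor_mul_T₁_symm, LinearMap.mul'_apply]

theorem exists_counit [Nontrivial A] : ∃ ε : A →ₗ[ℂ] ℂ,
    (∀ z, LinearMap.mul' ℂ A (D.T₁.symm z) = sliceLeft ε z) ∧
    (∀ z, LinearMap.mul' ℂ A (D.T₂.symm z) = sliceRight ε z) := by
  obtain ⟨x₀, hx₀⟩ := exists_ne (0 : A)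
  obtain ⟨f, hf⟩ := exists_functional_eq_one hx₀
  let ε : A →ₗ[ℂ] ℂ :=
    f ∘ₗ LinearMap.mul' ℂ A ∘ₗ D.T₂.symm.toLinearMap ∘ₗ TensorProduct.mk ℂ A A x₀
  -- The left side has first leg `x` and the right side has second leg `c`, so both are the same
  -- multiple of `x ⊗ c`; the scalar is `ε y`.
  have h1 : ∀ x y c, x ⊗ₜ[ℂ] (LinearMap.mul' ℂ A (D.T₁.symm (y ⊗ₜ c))) =
      LinearMap.mul' ℂ A (D.T₂.symm (x ⊗ₜ y)) ⊗ₜ c := fun x y c => by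
    rw [← lTensor_mul_T₁_symm']
    simp
  have h2 : ∀ y c, LinearMap.mul' ℂ A (D.T₁.symm (y ⊗ₜ c)) = ε y • c := fun y c => by
    have h := congrArg (sliceLeft f) (h1 x₀ y c)
    rw [sliceLeft_tmul, sliceLeft_tmul, hf, one_smul] at h
    exact h
  refine ⟨ε, fun z => ?_, fun z => ?_⟩
  · induction z with
    | zero => simp
    | add x y hx hy => simp only [map_add, hx, hy]
    | tmul x y => rw [h2, sliceLeft_tmul]
  · induction z with
    | zero => simp
    | add x y hx hy => simp only [map_add, hx, hy]
    | tmul x y =>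
      refine tmul_right_cancel hx₀ ?_
      rw [← h1, h2, sliceRight_tmul, TensorProduct.smul_tmul]

theorem isCounit_iff (ε : A →ₗ[ℂ] ℂ) : D.IsCounit ε ↔
    (∀ z, LinearMap.mul' ℂ A (D.T₁.symm z) = sliceLeft ε z) ∧
    (∀ z, LinearMap.mul' ℂ A (D.T₂.symm z) = sliceRight ε z) := by
  refine and_congr ⟨fun h z => ?_, fun h a b => ?_⟩ ⟨fun h z => ?_, fun h a b => ?_⟩
  · obtain ⟨z, rfl⟩ := D.T₁.surjective z
    rw [LinearEquiv.symm_apply_apply]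
    induction z with
    | zero => simp
    | add x y hx hy => simp only [map_add, hx, hy]
    | tmul x y => rw [h, LinearMap.mul'_apply]
  · rw [← h, LinearEquiv.symm_apply_apply, LinearMap.mul'_apply]
  · obtain ⟨z, rfl⟩ := D.T₂.surjective z
    rw [LinearEquiv.symm_apply_apply]
    induction z with
    | zero => simp
    | add x y hx hy => simp only [map_add, hx, hy]
    | tmul x y => rw [h, LinearMap.mul'_apply]
  · rw [← h, LinearEquiv.symm_apply_apply, LinearMap.mul'_apply]

variable [Nontrivial A]

theorem isCounit_counit : D.IsCounit D.counit :=
  Classical.epsilon_spec (p := D.IsCounit)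
    (let ⟨ε, h⟩ := D.exists_counit; ⟨ε, (D.isCounit_iff ε).mpr h⟩)

theorem mul'_T₁_symm (z : A ⊗[ℂ] A) :
    LinearMap.mul' ℂ A (D.T₁.symm z) = sliceLeft D.counit z :=
  ((D.isCounit_iff _).mp D.isCounit_counit).1 z

theorem mul'_T₂_symm (z : A ⊗[ℂ] A) :
    LinearMap.mul' ℂ A (D.T₂.symm z) = sliceRight D.counit z :=
  ((D.isCounit_iff _).mp D.isCounit_counit).2 z

theorem counit_sliceLeft_T₁ (z : A ⊗[ℂ] A) :
    sliceLeft D.counit (D.T₁ z) = LinearMap.mul' ℂ A z := by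
  rw [← mul'_T₁_symm, LinearEquiv.symm_apply_apply]

theorem counit_sliceRight_T₂ (z : A ⊗[ℂ] A) :
    sliceRight D.counit (D.T₂ z) = LinearMap.mul' ℂ A z := by
  rw [← mul'_T₂_symm, LinearEquiv.symm_apply_apply]

theorem counit_ne_zero : D.counit ≠ 0 := fun h => by
  obtain ⟨x, hx⟩ := exists_ne (0 : A)
  refine hx (D.nondegenerate_left x fun b => ?_)
  rw [← D.isCounit_counit.1 x b, h]
  simp [sliceLeft]

/-- The multiplication is `(ε ⊗ ι)T₁`, with `T₁` bijective and `ε` non-zero; so `A² = A`, which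
replaces a unit in later arguments. -/
theorem exists_mul'_eq (D : MultiplierHopfStarAlgebra A) (x : A) : ∃ z, LinearMap.mul' ℂ A z = x := by
  obtain ⟨z, hz⟩ := exists_sliceLeft_eq D.counit_ne_zero x
  exact ⟨D.T₁.symm z, by rw [mul'_T₁_symm, hz]⟩

theorem counit_mul (a b : A) : D.counit (a * b) = D.counit a * D.counit b := by
  have h1 : ∀ (a : A) z, sliceLeft D.counit (left (D.Δ a) z) = a * sliceLeft D.counit z :=
    fun a z => by
      obtain ⟨z, rfl⟩ := D.T₁.surjective z
      induction z with
      | zero => simp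
      | add x y hx hy => simp only [map_add, mul_add, hx, hy]
      | tmul x y => rw [comul_T₁, counit_sliceLeft_T₁, counit_sliceLeft_T₁]; simp [mul_assoc]
  have h2 : ∀ z, sliceLeft D.counit (rmulFst b z) = D.counit b • sliceLeft D.counit z := fun z => by
    obtain ⟨z, rfl⟩ := D.T₁.surjective z
    induction z with
    | zero => simp
    | add x y hx hy => simp only [map_add, smul_add, hx, hy]
    | tmul x y =>
      rw [rmulFst_T₁, h1, counit_sliceLeft_T₁]
      simp [mul_smul_comm]
  obtain ⟨c, hc⟩ := exists_ne (0 : A)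
  have h := h2 (a ⊗ₜ c)
  rw [LinearMap.rTensor_tmul, sliceLeft_tmul, sliceLeft_tmul, smul_smul] at h
  rw [mul_comm]
  exact smul_left_injective ℂ hc h

/-- The functional `conj ε(·⋆)` has the counit property for `T₄`. The covered element `(1 ⊗ d)Δ(x)(1
⊗ y)` transfers it to `T₁`, which determines the counit. -/
theorem counit_star (a : A) : D.counit (star a) = conj (D.counit a) := by
  let ε' : A →ₗ[ℂ] ℂ :=
    { toFun := fun x => conj (D.counit (star x))
      map_add' := by simp
      map_smul' := by simp }
  have hε : ∀ x, ε' (star x) = conj (D.counit x) := fun x => by simp [ε']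
  have hs : ∀ z : A ⊗[ℂ] A, sliceLeft ε' (star z) = star (sliceLeft D.counit z) := fun z => by
    induction z with
    | zero => simp
    | add x y hx hy => simp only [map_add, star_add, hx, hy]
    | tmul x y => simp [hε]
  have h1 : ∀ a b, sliceLeft ε' (D.T₄ (a ⊗ₜ b)) = b * a := fun a b => by
    rw [T₄, starConj_apply, hs, TensorProduct.star_tmul, counit_sliceLeft_T₁]
    simp
  have h2 : ∀ z, sliceLeft ε' z = sliceLeft D.counit z := fun z => by
    obtain ⟨z, rfl⟩ := D.T₁.surjective z
    induction z with
    | zero => simp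
    | add x y hx hy => simp only [map_add, hx, hy]
    | tmul x y =>
      refine D.mul_cancel_left fun d => ?_
      have h := congrArg (sliceLeft ε') (D.lmulSnd_T₁ d x y)
      rw [sliceLeft_lTensor, sliceLeft_lTensor, h1] at h
      rw [counit_sliceLeft_T₁]
      simpa [mul_assoc] using h
  obtain ⟨c, hc⟩ := exists_ne (0 : A)
  have h := h2 (star a ⊗ₜ c)
  rw [sliceLeft_tmul, sliceLeft_tmul] at h
  rw [← hε, smul_left_injective ℂ hc h]

end MultiplierHopfStarAlgebra

namespace MultiplierHopfStarAlgebra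

open Multiplier

variable {A : Type*} [NonUnitalRing A] [Module ℂ A] [IsScalarTower ℂ A A] [SMulCommClass ℂ A A]
  [StarRing A] [StarModule ℂ A] (D : MultiplierHopfStarAlgebra A)

/-! ### Convolution operators -/

/-- The operator `x ↦ (ι ⊗ ω)(Δ(x)(1 ⊗ c))`. -/
noncomputable def convRight (ω : A →ₗ[ℂ] ℂ) (c : A) : A →ₗ[ℂ] A :=
  sliceRight ω ∘ₗ D.T₁.toLinearMap ∘ₗ (TensorProduct.mk ℂ A A).flip c

/-- The operator `x ↦ (ω ⊗ ι)((a ⊗ 1)Δ(x))`. -/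
noncomputable def convLeft (ω : A →ₗ[ℂ] ℂ) (a : A) : A →ₗ[ℂ] A :=
  sliceLeft ω ∘ₗ D.T₂.toLinearMap ∘ₗ TensorProduct.mk ℂ A A a

/-- The operator `x ↦ (ι ⊗ ω)((1 ⊗ c)Δ(x))`. -/
noncomputable def convRight' (ω : A →ₗ[ℂ] ℂ) (c : A) : A →ₗ[ℂ] A :=
  sliceRight ω ∘ₗ D.T₄.toLinearMap ∘ₗ (TensorProduct.mk ℂ A A).flip c

/-- The operator `x ↦ (ω ⊗ ι)(Δ(x)(a ⊗ 1))`. -/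
noncomputable def convLeft' (ω : A →ₗ[ℂ] ℂ) (a : A) : A →ₗ[ℂ] A :=
  sliceLeft ω ∘ₗ D.T₃.toLinearMap ∘ₗ TensorProduct.mk ℂ A A a

theorem convRight_apply (ω : A →ₗ[ℂ] ℂ) (c x : A) :
    D.convRight ω c x = sliceRight ω (D.T₁ (x ⊗ₜ c)) := rfl

theorem convLeft_apply (ω : A →ₗ[ℂ] ℂ) (a x : A) :
    D.convLeft ω a x = sliceLeft ω (D.T₂ (a ⊗ₜ x)) := rfl

theorem convRight'_apply (ω : A →ₗ[ℂ] ℂ) (c x : A) :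
    D.convRight' ω c x = sliceRight ω (D.T₄ (x ⊗ₜ c)) := rfl

theorem T₂_tmul_sliceRight (ω : A →ₗ[ℂ] ℂ) (a : A) (w : A ⊗[ℂ] A) :
    D.T₂ (a ⊗ₜ sliceRight ω w) = (sliceRight ω).lTensor A (D.coact a w) := by
  induction w with
  | zero => simp
  | add x y hx hy => simp only [map_add, TensorProduct.tmul_add, hx, hy]
  | tmul u v =>
    rw [coact_tmul, lTensor_assoc_tmul, sliceRight_tmul, TensorProduct.tmul_smul, map_smul]
    generalize D.T₂ (a ⊗ₜ u) = z
    induction z with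
    | zero => simp
    | add x y hx hy => simp only [map_add, smul_add, hx, hy]
    | tmul x y => simp

/-- Coassociativity again: `x ↦ x₍₁₎ω(x₍₂₎c)` acts on the right end of an iterated coproduct and
`T₂` on its left end, so they commute. -/
theorem T₂_lTensor_convRight (ω : A →ₗ[ℂ] ℂ) (c : A) (z : A ⊗[ℂ] A) :
    D.T₂ ((D.convRight ω c).lTensor A z) = (D.convRight ω c).lTensor A (D.T₂ z) := by
  induction z with
  | zero => simp
  | add x y hx hy => simp only [map_add, hx, hy]
  | tmul a b =>
    rw [LinearMap.lTensor_tmul, convRight_apply, T₂_tmul_sliceRight, coact_T₁, coact_tmul,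
      ← LinearMap.comp_apply, ← LinearMap.lTensor_comp, lTensor_assoc_tmul]
    rfl

theorem T₃_lTensor_of_T₂ {P : A →ₗ[ℂ] A}
    (hP : ∀ z, D.T₂ (P.lTensor A z) = P.lTensor A (D.T₂ z)) (z : A ⊗[ℂ] A) :
    D.T₃ (P.lTensor A z) = P.lTensor A (D.T₃ z) := by
  induction z with
  | zero => simp
  | add x y hx hy => simp only [map_add, hx, hy]
  | tmul a b =>
    refine D.lmulFst_cancel fun d => ?_
    have h := hP (d ⊗ₜ b)
    rw [LinearMap.lTensor_tmul] at h ⊢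
    rw [lmulFst_T₃, h, ← lTensor_lmulFst, lmulFst_T₃, lTensor_rmulFst]

theorem T₁_rTensor_convLeft (ω : A →ₗ[ℂ] ℂ) (a : A) (w : A ⊗[ℂ] A) :
    D.T₁ ((D.convLeft ω a).rTensor A w) = (D.convLeft ω a).rTensor A (D.T₁ w) := by
  let sl : A ⊗[ℂ] (A ⊗[ℂ] A) →ₗ[ℂ] A ⊗[ℂ] A :=
    (TensorProduct.lid ℂ (A ⊗[ℂ] A)).toLinearMap ∘ₗ ω.rTensor (A ⊗[ℂ] A)
  have h1 : ∀ w, (D.convLeft ω a).rTensor A w = sl (D.coact a w) := fun w => by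
    induction w with
    | zero => simp
    | add x y hx hy => simp only [map_add, hx, hy]
    | tmul u v =>
      rw [coact_tmul, LinearMap.rTensor_tmul, convLeft_apply]
      generalize D.T₂ (a ⊗ₜ u) = z
      induction z with
      | zero => simp
      | add x y hx hy => simp only [map_add, TensorProduct.add_tmul, hx, hy]
      | tmul x y => simp [sl, TensorProduct.smul_tmul']
  have h2 : ∀ z, D.T₁ (sl z) = sl (D.T₁.toLinearMap.lTensor A z) := fun z => by
    induction z with
    | zero => simp
    | add x y hx hy => simp only [map_add, hx, hy]
    | tmul x y => simp [sl]
  rw [h1, h2, ← coact_T₁, ← h1]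

theorem mul_convRight (ω : A →ₗ[ℂ] ℂ) (c d x : A) :
    d * D.convRight ω c x = sliceRight (ω ∘ₗ LinearMap.mulRight ℂ c) (D.T₂ (d ⊗ₜ x)) := by
  have h := congrArg (sliceRight ω) (D.lmulFst_T₁ d x c)
  rwa [sliceRight_rTensor, sliceRight_lTensor] at h

theorem convRight'_mul (ω : A →ₗ[ℂ] ℂ) (c d x : A) :
    D.convRight' ω c x * d = sliceRight (ω ∘ₗ LinearMap.mulLeft ℂ c) (D.T₃ (d ⊗ₜ x)) := by
  have h := congrArg (sliceRight ω) (D.lmulSnd_T₃ c x d)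
  rw [sliceRight_lTensor, sliceRight_rTensor] at h
  exact h.symm

/-- Slices of the surjective `T₂` by a non-zero functional span `A`, so additive properties need
only be checked on them. -/
theorem convLeft_induction (ω : A →ₗ[ℂ] ℂ) (hω : ω ≠ 0) {p : A → Prop} (h0 : p 0)
    (hadd : ∀ x y, p x → p y → p (x + y)) (h : ∀ c x, p (D.convLeft ω c x)) (x : A) : p x := by
  obtain ⟨z, rfl⟩ := exists_sliceLeft_eq hω x
  obtain ⟨z, rfl⟩ := D.T₂.surjective z
  induction z with
  | zero => simpa
  | add x y hx hy => simpa using hadd _ _ hx hy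
  | tmul x y => exact h x y

theorem convRight_induction (ω : A →ₗ[ℂ] ℂ) (hω : ω ≠ 0) {p : A → Prop} (h0 : p 0)
    (hadd : ∀ x y, p x → p y → p (x + y)) (h : ∀ c x, p (D.convRight ω c x)) (x : A) : p x := by
  obtain ⟨z, rfl⟩ := exists_sliceRight_eq hω x
  obtain ⟨z, rfl⟩ := D.T₁.surjective z
  induction z with
  | zero => simpa
  | add x y hx hy => simpa using hadd _ _ hx hy
  | tmul x y => exact h y x

theorem convRight'_induction (ω : A →ₗ[ℂ] ℂ) (hω : ω ≠ 0) {p : A → Prop} (h0 : p 0)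
    (hadd : ∀ x y, p x → p y → p (x + y)) (h : ∀ c x, p (D.convRight' ω c x)) (x : A) : p x := by
  obtain ⟨z, rfl⟩ := exists_sliceRight_eq hω x
  obtain ⟨z, rfl⟩ := D.T₄.surjective z
  induction z with
  | zero => simpa
  | add x y hx hy => simpa using hadd _ _ hx hy
  | tmul x y => exact h y x

variable [Nontrivial A]

theorem counit_convRight (ω : A →ₗ[ℂ] ℂ) (c x : A) : D.counit (D.convRight ω c x) = ω (x * c) := by
  rw [convRight_apply, apply_sliceRight, ← apply_sliceLeft, counit_sliceLeft_T₁,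
    LinearMap.mul'_apply]

theorem counit_convLeft (ω : A →ₗ[ℂ] ℂ) (a x : A) : D.counit (D.convLeft ω a x) = ω (a * x) := by
  rw [convLeft_apply, apply_sliceLeft, ← apply_sliceRight, counit_sliceRight_T₂,
    LinearMap.mul'_apply]

/-! ### The antipode -/

/-- The map `x ⊗ y ↦ S(x) y`. -/
noncomputable def antipodeMul : A ⊗[ℂ] A →ₗ[ℂ] A := sliceLeft D.counit ∘ₗ D.T₁.symm.toLinearMap

theorem antipodeMul_T₁ (z : A ⊗[ℂ] A) : D.antipodeMul (D.T₁ z) = sliceLeft D.counit z := by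
  simp [antipodeMul]

theorem antipodeMul_rmulSnd (c : A) (z : A ⊗[ℂ] A) :
    D.antipodeMul (rmulSnd c z) = D.antipodeMul z * c := by
  obtain ⟨z, rfl⟩ := D.T₁.surjective z
  rw [← T₁_rmulSnd, antipodeMul_T₁, antipodeMul_T₁, sliceLeft_lTensor, LinearMap.mulRight_apply]

theorem antipodeMul_comul (a : A) (z : A ⊗[ℂ] A) :
    D.antipodeMul (left (D.Δ a) z) = D.counit a • D.antipodeMul z := by
  obtain ⟨z, rfl⟩ := D.T₁.surjective z
  induction z with
  | zero => simp
  | add x y hx hy => simp only [map_add, smul_add, hx, hy]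
  | tmul x y =>
    rw [comul_T₁, antipodeMul_T₁, antipodeMul_T₁, sliceLeft_tmul, sliceLeft_tmul, counit_mul,
      smul_smul]

/-- This is the covered form of `T₁⁻¹(u ⊗ v) = u₍₁₎ ⊗ S(u₍₂₎)v`. -/
theorem lTensor_antipodeMul_coact (a : A) (w : A ⊗[ℂ] A) :
    D.antipodeMul.lTensor A (D.coact a w) = lmulFst a (D.T₁.symm w) := by
  have h : ∀ w, (sliceLeft D.counit).lTensor A (D.coact a w) = lmulFst a w := fun w => by
    induction w with
    | zero => simp
    | add x y hx hy => simp only [map_add, hx, hy]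
    | tmul u v =>
      rw [coact_tmul, lTensor_assoc_tmul, LinearMap.rTensor_tmul, LinearMap.mulLeft_apply,
        ← LinearMap.mul'_apply (R := ℂ), ← counit_sliceRight_T₂]
      generalize D.T₂ (a ⊗ₜ u) = z
      induction z with
      | zero => simp
      | add x y hx hy => simp only [map_add, TensorProduct.add_tmul, hx, hy]
      | tmul x y => simp [TensorProduct.smul_tmul]
  rw [← h, coact_T₁_symm, antipodeMul, LinearMap.lTensor_comp]
  rfl

theorem exists_antipodeFun : ∃ S : A →ₗ[ℂ] A, (∀ x y, S x * y = D.antipodeMul (x ⊗ₜ y)) ∧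
    ∀ x y, D.antipodeMul (D.T₃ (x ⊗ₜ y)) = D.counit y • S x := by
  obtain ⟨a, ha⟩ : ∃ a, D.counit a = 1 := by
    by_contra! h
    refine D.counit_ne_zero (LinearMap.ext fun x => ?_)
    by_contra hx
    exact h ((D.counit x)⁻¹ • x) (by simpa using inv_mul_cancel₀ hx)
  have h : ∀ x y c, D.antipodeMul (D.T₃ (x ⊗ₜ y)) * c = D.counit y • D.antipodeMul (x ⊗ₜ c) :=
    fun x y c => by rw [← antipodeMul_rmulSnd, rmulSnd_T₃, antipodeMul_comul]
  -- `S(x)` is a priori only a left multiplier. With `ε(a) = 1` the element `S(x₁)x₂` formed from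
  -- `Δ(a)(x ⊗ 1)` in place of `x₁ ⊗ x₂` represents it in `A`.
  refine ⟨D.antipodeMul ∘ₗ D.T₃.toLinearMap ∘ₗ (TensorProduct.mk ℂ A A).flip a, fun x y => ?_,
    fun x y => D.mul_cancel_right fun d => ?_⟩
  · have := h x a y
    rw [ha, one_smul] at this
    exact this
  · rw [h, smul_mul_assoc]
    have := h x a d
    rw [ha, one_smul] at this
    rw [← this]
    rfl

theorem antipodeFun_left {S : A →ₗ[ℂ] A} (hS : ∀ x y, S x * y = D.antipodeMul (x ⊗ₜ y))
    (z : A ⊗[ℂ] A) :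
    LinearMap.mul' ℂ A (S.rTensor A z) = D.antipodeMul z := by
  induction z with
  | zero => simp
  | add x y hx hy => simp only [map_add, hx, hy]
  | tmul x y => simp [hS]

theorem antipodeFun_right {S : A →ₗ[ℂ] A} (hS : ∀ x y, S x * y = D.antipodeMul (x ⊗ₜ y))
    (a y : A) :
    LinearMap.mul' ℂ A (S.lTensor A (D.T₂ (a ⊗ₜ y))) = D.counit y • a := by
  refine D.mul_cancel_right fun m => ?_
  have h := congrArg (LinearMap.mul' ℂ A) (D.lTensor_antipodeMul_coact a (y ⊗ₜ m))
  rw [mul'_lmulFst, mul'_T₁_symm, sliceLeft_tmul, coact_tmul, lTensor_assoc_tmul] at h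
  rw [smul_mul_assoc, ← mul_smul_comm, ← h, ← mul'_rmulSnd]
  generalize D.T₂ (a ⊗ₜ y) = z
  induction z with
  | zero => simp
  | add x y hx hy => simp only [map_add, hx, hy]
  | tmul x y => simp [hS]

theorem mul_antipodeFun {S : A →ₗ[ℂ] A} (hS : ∀ x y, S x * y = D.antipodeMul (x ⊗ₜ y))
    (d x : A) : d * S x = sliceRight D.counit (D.T₂.symm (d ⊗ₜ x)) := by
  have h : ∀ z, LinearMap.mul' ℂ A (S.lTensor A (D.T₂ z)) = sliceRight D.counit z := fun z => by
    induction z with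
    | zero => simp
    | add x y hx hy => simp only [map_add, hx, hy]
    | tmul x y => rw [D.antipodeFun_right hS, sliceRight_tmul]
  rw [← h, LinearEquiv.apply_symm_apply]
  simp

theorem antipodeFun_mul {S : A →ₗ[ℂ] A} (hS : ∀ x y, S x * y = D.antipodeMul (x ⊗ₜ y))
    (x y : A) : S (x * y) = S y * S x := by
  refine D.mul_cancel_right fun d => ?_
  have h : ∀ z, D.antipodeMul (rmulFst y z) = S y * D.antipodeMul z := fun z => by
    obtain ⟨z, rfl⟩ := D.T₁.surjective z
    induction z with
    | zero => simp
    | add x y hx hy => simp only [map_add, mul_add, hx, hy]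
    | tmul p q =>
      rw [rmulFst_T₁, antipodeMul_comul, antipodeMul_T₁, sliceLeft_tmul, mul_smul_comm, hS]
  have h' := h (x ⊗ₜ d)
  rw [LinearMap.rTensor_tmul, LinearMap.mulRight_apply, ← hS, ← hS] at h'
  rw [h', mul_assoc]

/-- The convolution operator commutes with `T₂⁻¹`, and the counit composed with it is `ω(· c)`. -/
theorem antipodeFun_convRight_mul {S : A →ₗ[ℂ] A} (hS : ∀ x y, S x * y = D.antipodeMul (x ⊗ₜ y))
    (ω : A →ₗ[ℂ] ℂ) (c d x : A) :
    d * S (D.convRight ω c x) =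
      sliceRight (ω ∘ₗ LinearMap.mulRight ℂ c) (D.T₂.symm (d ⊗ₜ x)) := by
  have h : D.T₂.symm (d ⊗ₜ D.convRight ω c x) =
      (D.convRight ω c).lTensor A (D.T₂.symm (d ⊗ₜ x)) := by
    rw [LinearEquiv.symm_apply_eq, T₂_lTensor_convRight, LinearEquiv.apply_symm_apply,
      LinearMap.lTensor_tmul]
  rw [D.mul_antipodeFun hS, h, sliceRight_lTensor]
  congr 1
  congr 1
  ext x
  simp [counit_convRight]

end MultiplierHopfStarAlgebra

/-! ### Positivity, strong left invariance and the inverse of the antipode -/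

namespace MultiplierHopfStarAlgebra

open Multiplier

variable {A : Type*} [NonUnitalRing A] [Module ℂ A] [IsScalarTower ℂ A A] [SMulCommClass ℂ A A]
  [StarRing A] [StarModule ℂ A] {D : MultiplierHopfStarAlgebra A}

theorem right_comul (b : A) (z : A ⊗[ℂ] A) :
    right (D.Δ b) z = star (left (D.Δ (star b)) (star z)) := by
  rw [← right_star, ← map_star D.Δ, star_star]

theorem right_comul_T₂ (a b c : A) :
    right (D.Δ c) (D.T₂ (a ⊗ₜ b)) = D.T₂ (a ⊗ₜ (b * c)) := by
  have h := D.comul_T₃ (star c) (star b) (star a)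
  rw [T₃, starConj_apply, starConj_apply, ← TensorProduct.star_tmul, star_star] at h
  rw [right_comul, h, star_star, TensorProduct.star_tmul, star_mul, star_star, star_star, star_star]

theorem lmulFst_T₄ (a c d : A) : lmulFst d (D.T₄ (a ⊗ₜ c)) = right (D.Δ a) (d ⊗ₜ c) := by
  have h : ∀ z, lmulFst d (star z) = star (rmulFst (star d) z) := fun z => by
    induction z with
    | zero => simp
    | add x y hx hy => simp only [map_add, star_add, hx, hy]
    | tmul x y => simp
  rw [T₄, starConj_apply, h, TensorProduct.star_tmul, rmulFst_T₁, right_comul,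
    TensorProduct.star_tmul]

variable {φ : A →ₗ[ℂ] ℂ}

theorem IsLeftIntegral.nontrivial (hφ : D.IsLeftIntegral φ) : Nontrivial A := by
  by_contra h
  rw [not_nontrivial_iff_subsingleton] at h
  exact hφ.1 (LinearMap.ext fun x => by rw [Subsingleton.elim x 0, map_zero, map_zero])

/-- Polarization: `φ(a⋆a)` is real for `a = x + y` and for `a = x + iy`. -/
theorem conj_symm_of_nonneg (hpos : ∀ a : A, 0 ≤ φ (star a * a)) (x y : A) :
    conj (φ (star y * x)) = φ (star x * y) := by
  have him : ∀ a, (φ (star a * a)).im = 0 := fun a => (Complex.nonneg_iff.mp (hpos a)).2.symm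
  have h1 := him (x + y)
  have h2 := him (x + Complex.I • y)
  simp only [star_add, star_smul, add_mul, mul_add, map_add, Complex.add_im, him, smul_mul_assoc,
    mul_smul_comm, map_smul, smul_eq_mul] at h1 h2
  simp [Complex.mul_im, him] at h1 h2
  apply Complex.ext
  · rw [Complex.conj_re]; linarith
  · rw [Complex.conj_im]; linarith

theorem map_star_of_nonneg (D : MultiplierHopfStarAlgebra A) [Nontrivial A]
    (hpos : ∀ a : A, 0 ≤ φ (star a * a)) (x : A) :
    φ (star x) = conj (φ x) := by
  obtain ⟨z, rfl⟩ := D.exists_mul'_eq x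
  induction z with
  | zero => simp
  | add x y hx hy => simp only [map_add, star_add, hx, hy]
  | tmul x y =>
    have h := conj_symm_of_nonneg hpos y (star x)
    rw [star_star] at h
    rw [LinearMap.mul'_apply, star_mul, h]

theorem IsLeftIntegral.sliceRight_T₂ (hφ : D.IsLeftIntegral φ)
    (z : A ⊗[ℂ] A) :
    sliceRight φ (D.T₂ z) = sliceRight φ z := by
  induction z with
  | zero => simp
  | add x y hx hy => simp only [map_add, hx, hy]
  | tmul x y => rw [hφ.2, sliceRight_tmul]

theorem IsLeftIntegral.sliceRight_T₃ (hφ : D.IsLeftIntegral φ)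
    (hstar : ∀ x, φ (star x) = conj (φ x))
    (z : A ⊗[ℂ] A) :
    sliceRight φ (D.T₃ z) = sliceRight φ z := by
  rw [T₃, starConj_apply, sliceRight_star hstar, hφ.sliceRight_T₂, ← sliceRight_star hstar,
    star_star]

theorem star_convRight (hstar : ∀ x, φ (star x) = conj (φ x))
    (c x : A) :
    star (D.convRight φ c x) = D.convRight' φ (star c) (star x) := by
  rw [convRight'_apply, T₄, starConj_apply, sliceRight_star hstar, TensorProduct.star_tmul,
    star_star, star_star, convRight_apply]

theorem star_convRight' (hstar : ∀ x, φ (star x) = conj (φ x))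
    (c x : A) :
    star (D.convRight' φ c x) = D.convRight φ (star c) (star x) := by
  rw [← star_star (D.convRight φ (star c) (star x)), star_convRight hstar, star_star, star_star]

theorem T₃_lTensor_convRight (ω : A →ₗ[ℂ] ℂ) (c : A) (z : A ⊗[ℂ] A) :
    D.T₃ ((D.convRight ω c).lTensor A z) = (D.convRight ω c).lTensor A (D.T₃ z) :=
  D.T₃_lTensor_of_T₂ (D.T₂_lTensor_convRight ω c) z

theorem T₃_lTensor_convRight' (hstar : ∀ x, φ (star x) = conj (φ x))
    (c : A) (z : A ⊗[ℂ] A) :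
    D.T₃ ((D.convRight' φ c).lTensor A z) = (D.convRight' φ c).lTensor A (D.T₃ z) := by
  have h : ∀ z, star ((D.convRight' φ c).lTensor A z) =
      (D.convRight φ (star c)).lTensor A (star z) := fun z => by
    induction z with
    | zero => simp
    | add x y hx hy => simp only [map_add, star_add, hx, hy]
    | tmul x y => simp [star_convRight' hstar]
  rw [T₃, starConj_apply, h, T₂_lTensor_convRight, starConj_apply,
    ← star_star ((D.convRight' φ c).lTensor A _), h, star_star]

variable [Nontrivial A]

/-- Strong left invariance. -/
theorem IsLeftIntegral.antipodeFun_convRight (hφ : D.IsLeftIntegral φ)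
    {S : A →ₗ[ℂ] A}
    (hS : ∀ x y, S x * y = D.antipodeMul (x ⊗ₜ y)) (b y : A) :
    S (D.convRight φ b y) = D.convRight' φ y b := by
  refine D.mul_cancel_left fun d => ?_
  -- Since `T₂(p ⊗ q)Δ(b) = T₂(p ⊗ qb)`, left invariance removes `T₂`; the formula is then used at
  -- `z = T₂⁻¹(d ⊗ y)`.
  have h : ∀ z, sliceRight φ (right (D.Δ b) (D.T₂ z)) =
      sliceRight (φ ∘ₗ LinearMap.mulRight ℂ b) z := fun z => by
    induction z with
    | zero => simp
    | add x y hx hy => simp only [map_add, hx, hy]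
    | tmul p q => rw [right_comul_T₂, hφ.sliceRight_T₂]; simp
  rw [D.antipodeFun_convRight_mul hS, ← h, LinearEquiv.apply_symm_apply, ← lmulFst_T₄,
    sliceRight_rTensor, LinearMap.mulLeft_apply, convRight'_apply]

/-- On slices by `φ`, both `S` and the involution exchange `convRight` and `convRight'`, so going
round twice returns to the start. Bijectivity of `S` follows. -/
theorem IsLeftIntegral.star_antipodeFun_star (hφ : D.IsLeftIntegral φ)
    (hstar : ∀ x, φ (star x) = conj (φ x))
    {S : A →ₗ[ℂ] A}
    (hS : ∀ x y, S x * y = D.antipodeMul (x ⊗ₜ y)) (x : A) : star (S (star (S x))) = x := by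
  refine D.convRight_induction φ hφ.1 (p := fun x => star (S (star (S x))) = x) (by simp)
    (fun x y hx hy => by rw [map_add, star_add, map_add, star_add, hx, hy]) (fun c x => ?_) x
  rw [hφ.antipodeFun_convRight hS, star_convRight' hstar, hφ.antipodeFun_convRight hS,
    star_convRight' hstar, star_star, star_star]

theorem IsLeftIntegral.isAntipode_antipode (hφ : D.IsLeftIntegral φ)
    (hstar : ∀ x, φ (star x) = conj (φ x))
    : D.IsAntipode D.antipode := by
  refine @Classical.epsilon_spec_aux _ ⟨LinearEquiv.refl ℂ A⟩ D.IsAntipode ?_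
  obtain ⟨S, hS, -⟩ := D.exists_antipodeFun
  have h := hφ.star_antipodeFun_star hstar hS
  refine ⟨LinearEquiv.ofBijective S ⟨fun x y hxy => by rw [← h x, hxy, h], fun x =>
    ⟨star (S (star x)), ?_⟩⟩, fun a b => ?_, fun a b => ?_⟩
  · have := h (star x)
    exact star_injective this
  · exact (D.antipodeFun_left hS _).trans ((D.antipodeMul_T₁ _).trans (sliceLeft_tmul _ _ _))
  · exact D.antipodeFun_right hS b a

theorem IsLeftIntegral.antipode_mul (hφ : D.IsLeftIntegral φ)
    (hstar : ∀ x, φ (star x) = conj (φ x))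
    (x y : A) :
    D.antipode x * y = D.antipodeMul (x ⊗ₜ y) := by
  have h : ∀ z, LinearMap.mul' ℂ A (D.antipode.toLinearMap.rTensor A (D.T₁ z)) =
      sliceLeft D.counit z := fun z => by
    induction z with
    | zero => simp
    | add x y hx hy => simp only [map_add, hx, hy]
    | tmul x y => rw [(hφ.isAntipode_antipode hstar).1, sliceLeft_tmul]
  have := h (D.T₁.symm (x ⊗ₜ y))
  rw [LinearEquiv.apply_symm_apply] at this
  simpa [antipodeMul] using this

theorem IsLeftIntegral.antipode_symm (hφ : D.IsLeftIntegral φ)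
    (hstar : ∀ x, φ (star x) = conj (φ x))
    (x : A) :
    D.antipode.symm x = star (D.antipode (star x)) := by
  have h := hφ.star_antipodeFun_star hstar (S := D.antipode.toLinearMap)
    (hφ.antipode_mul hstar) (D.antipode.symm x)
  simpa using h.symm

theorem IsLeftIntegral.antipode_antimul (hφ : D.IsLeftIntegral φ)
    (hstar : ∀ x, φ (star x) = conj (φ x))
    (x y : A) :
    D.antipode (x * y) = D.antipode y * D.antipode x :=
  D.antipodeFun_mul (S := D.antipode.toLinearMap) (hφ.antipode_mul hstar) x y

theorem IsLeftIntegral.antipode_convRight (hφ : D.IsLeftIntegral φ)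
    (hstar : ∀ x, φ (star x) = conj (φ x))
    (b y : A) :
    D.antipode (D.convRight φ b y) = D.convRight' φ y b :=
  hφ.antipodeFun_convRight (S := D.antipode.toLinearMap) (hφ.antipode_mul hstar) b y

theorem IsLeftIntegral.antipodeMul_T₃ (hφ : D.IsLeftIntegral φ)
    (hstar : ∀ x, φ (star x) = conj (φ x))
    (x y : A) :
    D.antipodeMul (D.T₃ (x ⊗ₜ y)) = D.counit y • D.antipode x := by
  obtain ⟨S, hS, h⟩ := D.exists_antipodeFun
  rw [h]
  congr 1
  exact D.mul_cancel_right fun d => by rw [hS, hφ.antipode_mul hstar]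

/-- `S⁻¹(x₍₁₎)c ⊗ x₍₂₎`, sliced by the counit, is `S⁻¹(x)c`. -/
theorem IsLeftIntegral.antipode_symm_mul (hφ : D.IsLeftIntegral φ)
    (hstar : ∀ x, φ (star x) = conj (φ x))
    (c x : A) :
    D.antipode.symm x * c = sliceRight D.counit (D.T₃.symm (c ⊗ₜ x)) := by
  rw [T₃, starConj_symm_apply, sliceRight_star D.counit_star, TensorProduct.star_tmul,
    ← D.mul_antipodeFun (S := D.antipode.toLinearMap) (hφ.antipode_mul hstar),
    hφ.antipode_symm hstar, star_mul, star_star]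
  rfl

theorem IsLeftIntegral.antipode_symm_convRight_mul (hφ : D.IsLeftIntegral φ)
    (hstar : ∀ x, φ (star x) = conj (φ x))
    (ω : A →ₗ[ℂ] ℂ) (c d x : A) :
    D.antipode.symm (D.convRight ω c x) * d =
      sliceRight (ω ∘ₗ LinearMap.mulRight ℂ c) (D.T₃.symm (d ⊗ₜ x)) := by
  have h : D.T₃.symm (d ⊗ₜ D.convRight ω c x) =
      (D.convRight ω c).lTensor A (D.T₃.symm (d ⊗ₜ x)) := by
    rw [LinearEquiv.symm_apply_eq, T₃_lTensor_convRight, LinearEquiv.apply_symm_apply,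
      LinearMap.lTensor_tmul]
  rw [hφ.antipode_symm_mul hstar, h, sliceRight_lTensor]
  congr 1
  congr 1
  ext x
  simp [counit_convRight]

/-! ### Faithfulness of the integral -/

theorem IsLeftIntegral.eq_zero_of_forall_mul (hφ : D.IsLeftIntegral φ)
    (hstar : ∀ x, φ (star x) = conj (φ x))
    (n : A) (hn : ∀ x, φ (x * n) = 0) : n = 0 := by
  -- `N` is the left kernel ideal. By strong left invariance the second leg of `Δ(N)` stays in `N`,
  -- so it suffices that the counit vanishes on `N`.
  let N : Submodule ℂ A := ⨅ x : A, LinearMap.ker (φ ∘ₗ LinearMap.mulLeft ℂ x)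
  have memN : ∀ m, m ∈ N ↔ ∀ x, φ (x * m) = 0 := fun m => by
    simp [N, Submodule.mem_iInf]
  have hconv : ∀ m ∈ N, ∀ y, D.convRight' φ y m = 0 := fun m hm y => by
    have h0 : φ ∘ₗ LinearMap.mulRight ℂ m = 0 := LinearMap.ext ((memN m).mp hm)
    have : D.convRight φ m y = 0 := D.mul_cancel_left fun d => by
      rw [mul_convRight, h0]
      simp [sliceRight]
    rw [← hφ.antipode_convRight hstar, this, map_zero]
  have hslice : ∀ m ∈ N, ∀ c ω, sliceLeft ω (D.T₃ (c ⊗ₜ m)) ∈ N := fun m hm c ω =>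
    (memN _).mpr fun y => by
      have h := D.convRight'_mul φ y c m
      rw [hconv m hm, zero_mul] at h
      change (φ ∘ₗ LinearMap.mulLeft ℂ y) _ = 0
      rw [apply_sliceLeft, ← apply_sliceRight, ← h, map_zero]
  have hcounit : ∀ m ∈ N, D.counit m = 0 := fun m hm => by
    by_contra hne
    -- `ε(m)S(c)` is `S(x₁)x₂` summed over `Δ(m)(c ⊗ 1)`, whose second leg lies in the left ideal
    -- `N`. Hence `N = A`, and `φ` vanishes on `A² = A`.
    have hmem : ∀ c, D.antipode c ∈ N := fun c => by
      obtain ⟨s, k, hk, hs⟩ := exists_sum_of_sliceLeft_mem N _ (hslice m hm c)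
      have h := hφ.antipodeMul_T₃ hstar c m
      rw [hs, map_sum] at h
      have : D.counit m • D.antipode c ∈ N := by
        rw [← h]
        refine N.sum_mem fun i _ => ?_
        rw [← hφ.antipode_mul hstar, memN]
        intro x
        rw [← mul_assoc]
        exact (memN _).mp (hk i) _
      exact (N.smul_mem_iff hne).mp this
    refine hφ.1 (LinearMap.ext fun x => ?_)
    obtain ⟨z, rfl⟩ := D.exists_mul'_eq x
    induction z with
    | zero => simp
    | add x y hx hy =>
      rw [LinearMap.zero_apply] at hx hy ⊢
      rw [map_add, map_add, hx, hy, add_zero]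
    | tmul x y =>
      have := (memN _).mp (hmem (D.antipode.symm y)) x
      simpa using this
  refine D.nondegenerate_left n fun c => ?_
  have hzero : sliceRight D.counit (D.T₃ (c ⊗ₜ n)) = 0 := eq_of_forall_functional fun ω => by
    rw [apply_sliceRight, ← apply_sliceLeft, hcounit _ (hslice n ((memN n).mpr hn) c ω), map_zero]
  rw [T₃, starConj_apply, sliceRight_star D.counit_star, TensorProduct.star_tmul,
    counit_sliceRight_T₂, LinearMap.mul'_apply, star_mul, star_star, star_star] at hzero
  exact hzero

theorem IsLeftIntegral.fourier_injective (hφ : D.IsLeftIntegral φ)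
    (hstar : ∀ x, φ (star x) = conj (φ x))
    : Function.Injective (fourierTransform φ) := by
  rw [injective_iff_map_eq_zero]
  intro a ha
  refine hφ.eq_zero_of_forall_mul hstar a fun x => ?_
  exact LinearMap.congr_fun (congrArg Subtype.val ha) x

end MultiplierHopfStarAlgebra

/-! ### Left invariance on `Δ(x) T₃(z)` -/

namespace MultiplierHopfStarAlgebra

open Multiplier

variable {A : Type*} [NonUnitalRing A] [Module ℂ A] [IsScalarTower ℂ A A] [SMulCommClass ℂ A A]
  [StarRing A] [StarModule ℂ A] {D : MultiplierHopfStarAlgebra A} {φ : A →ₗ[ℂ] ℂ}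

theorem IsLeftIntegral.sliceRight_comul_T₃ (hφ : D.IsLeftIntegral φ)
    (hstar : ∀ x, φ (star x) = conj (φ x)) (x : A) (z : A ⊗[ℂ] A) :
    sliceRight φ (left (D.Δ x) (D.T₃ z)) = sliceRight (φ ∘ₗ LinearMap.mulLeft ℂ x) z := by
  induction z with
  | zero => simp
  | add x y hx hy => simp only [map_add, hx, hy]
  | tmul p q => rw [comul_T₃, hφ.sliceRight_T₃ hstar]; simp

theorem IsLeftIntegral.tensorFunctional_comul_T₃ (hφ : D.IsLeftIntegral φ)
    (hstar : ∀ x, φ (star x) = conj (φ x)) (ω : A →ₗ[ℂ] ℂ) (x : A) (z : A ⊗[ℂ] A) :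
    tensorFunctional ω φ (left (D.Δ x) (D.T₃ z)) = φ (x * sliceLeft ω z) := by
  rw [← apply_sliceRight, hφ.sliceRight_comul_T₃ hstar, apply_sliceRight, ← apply_sliceLeft]
  rfl

theorem IsLeftIntegral.convRight_mul_eq (hφ : D.IsLeftIntegral φ)
    (hstar : ∀ x, φ (star x) = conj (φ x)) (b q x : A) :
    D.convRight φ b x * q =
      sliceRight (φ ∘ₗ LinearMap.mulLeft ℂ x) (D.T₃.symm (q ⊗ₜ b)) := by
  rw [← hφ.sliceRight_comul_T₃ hstar, LinearEquiv.apply_symm_apply, ← rmulFst_T₁,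
    sliceRight_rTensor]
  rfl

/-! ### The right integral -/

variable [Nontrivial A]

/-- The right integral `φ ∘ S`. -/
noncomputable def rightIntegral (D : MultiplierHopfStarAlgebra A) (φ : A →ₗ[ℂ] ℂ) : A →ₗ[ℂ] ℂ :=
  φ ∘ₗ D.antipode.toLinearMap

theorem rightIntegral_apply (x : A) : D.rightIntegral φ x = φ (D.antipode x) := rfl

theorem IsLeftIntegral.sliceRight_T₁_convRight (hφ : D.IsLeftIntegral φ)
    (hstar : ∀ x, φ (star x) = conj (φ x)) (ω : A →ₗ[ℂ] ℂ) (b q y : A) :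
    sliceRight ω (D.T₁ (D.convRight φ b y ⊗ₜ q)) =
      D.convRight φ (sliceLeft ω (D.T₃.symm (q ⊗ₜ b))) y := by
  refine D.mul_cancel_left fun d => ?_
  have h := D.T₂_lTensor_convRight φ b (d ⊗ₜ y)
  rw [LinearMap.lTensor_tmul] at h
  rw [← convRight_apply, mul_convRight, mul_convRight, h, sliceRight_lTensor]
  congr 1
  congr 1
  ext v
  simp only [LinearMap.comp_apply, LinearMap.mulRight_apply]
  rw [hφ.convRight_mul_eq hstar, apply_sliceRight, ← apply_sliceLeft]
  rfl

/-- Right invariance of `φ ∘ S`. On elements `convRight φ b y`, the coproduct only alters `b`,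
through `T₃⁻¹`; after `S` this is left invariance of `φ` with respect to `T₃`. -/
theorem IsLeftIntegral.sliceLeft_T₁ (hφ : D.IsLeftIntegral φ)
    (hstar : ∀ x, φ (star x) = conj (φ x)) (z : A ⊗[ℂ] A) :
    sliceLeft (D.rightIntegral φ) (D.T₁ z) = sliceLeft (D.rightIntegral φ) z := by
  induction z with
  | zero => simp
  | add x y hx hy => simp only [map_add, hx, hy]
  | tmul x q =>
    refine D.convRight_induction φ hφ.1
      (p := fun x => sliceLeft (D.rightIntegral φ) (D.T₁ (x ⊗ₜ q)) = sliceLeft _ (x ⊗ₜ q))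
      (by simp) (fun x y hx hy => by rw [TensorProduct.add_tmul, map_add, map_add, hx, hy, map_add])
      (fun b y => eq_of_forall_functional fun ω => ?_) x
    have h : D.T₃ ((D.convRight' φ y).lTensor A (D.T₃.symm (q ⊗ₜ b))) =
        q ⊗ₜ D.convRight' φ y b := by
      rw [T₃_lTensor_convRight' hstar, LinearEquiv.apply_symm_apply, LinearMap.lTensor_tmul]
    have h' := congrArg (sliceRight φ) h
    rw [hφ.sliceRight_T₃ hstar, sliceRight_lTensor, sliceRight_tmul] at h'
    rw [apply_sliceLeft, ← apply_sliceRight, hφ.sliceRight_T₁_convRight hstar,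
      rightIntegral_apply, hφ.antipode_convRight hstar, sliceLeft_tmul, rightIntegral_apply,
      hφ.antipode_convRight hstar, ← h', apply_sliceRight, ← apply_sliceLeft]
    rfl

theorem IsLeftIntegral.exists_rightIntegral_mul_eq (hφ : D.IsLeftIntegral φ)
    (hstar : ∀ x, φ (star x) = conj (φ x)) (p : A) :
    ∃ e, ∀ x, D.rightIntegral φ (x * p) = φ (x * e) := by
  obtain ⟨q, hq⟩ : ∃ q, φ q = 1 := by
    by_contra! h
    refine hφ.1 (LinearMap.ext fun x => ?_)
    by_contra hx
    exact h ((φ x)⁻¹ • x) (by simpa using inv_mul_cancel₀ hx)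
  -- Evaluate `(φS ⊗ φ)(Δ(x) T₁(p ⊗ q))` twice: right invariance gives `φS(xp)φ(q)`, and left
  -- invariance, after writing `T₁(p ⊗ q)` as an image of `T₃`, gives `φ(xe)`.
  refine ⟨sliceLeft (D.rightIntegral φ) (D.T₃.symm (D.T₁ (p ⊗ₜ q))), fun x => ?_⟩
  rw [← hφ.tensorFunctional_comul_T₃ hstar, LinearEquiv.apply_symm_apply, comul_T₁,
    ← apply_sliceLeft, hφ.sliceLeft_T₁ hstar, sliceLeft_tmul, map_smul, hq, smul_eq_mul, mul_one]

theorem IsLeftIntegral.exists_mul_antipode_eq (hφ : D.IsLeftIntegral φ)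
    (hstar : ∀ x, φ (star x) = conj (φ x)) (c : A) :
    ∃ e, ∀ x, φ (c * D.antipode x) = φ (x * e) := by
  obtain ⟨e, he⟩ := hφ.exists_rightIntegral_mul_eq hstar (D.antipode.symm c)
  refine ⟨e, fun x => ?_⟩
  rw [← he, rightIntegral_apply, hφ.antipode_antimul hstar, LinearEquiv.apply_symm_apply]

/-- Strong right invariance. -/
theorem IsLeftIntegral.antipode_convLeft (hφ : D.IsLeftIntegral φ)
    (hstar : ∀ x, φ (star x) = conj (φ x)) (x d : A) :
    D.antipode (D.convLeft (D.rightIntegral φ) x d) = D.convLeft' (D.rightIntegral φ) d x := by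
  refine D.mul_cancel_right fun c => ?_
  have h : ∀ w, sliceLeft (D.rightIntegral φ) (left (D.Δ x) (D.T₁ w)) =
      sliceLeft (D.rightIntegral φ ∘ₗ LinearMap.mulLeft ℂ x) w := fun w => by
    induction w with
    | zero => simp
    | add x y hx hy => simp only [map_add, hx, hy]
    | tmul p q => rw [comul_T₁, hφ.sliceLeft_T₁ hstar]; simp
  have h1 : D.convLeft' (D.rightIntegral φ) d x * c =
      sliceLeft (D.rightIntegral φ) (left (D.Δ x) (d ⊗ₜ c)) := by
    rw [← rmulSnd_T₃, sliceLeft_lTensor]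
    rfl
  have h2 : (D.convLeft (D.rightIntegral φ) x d) ⊗ₜ c =
      (D.convLeft (D.rightIntegral φ) x).rTensor A (d ⊗ₜ c) := rfl
  obtain ⟨w, hw⟩ := D.T₁.surjective (d ⊗ₜ c)
  rw [h1, hφ.antipode_mul hstar, h2, ← hw, h, ← T₁_rTensor_convLeft, antipodeMul_T₁,
    sliceLeft_rTensor]
  congr 1
  congr 1
  ext p
  simp [counit_convLeft]

/-- The functionals `φ(y ·)` belong to the dual. -/
theorem IsLeftIntegral.exists_modular (hφ : D.IsLeftIntegral φ)
    (hstar : ∀ x, φ (star x) = conj (φ x)) (y : A) : ∃ e, ∀ x, φ (y * x) = φ (x * e) := by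
  have hne : D.rightIntegral φ ∘ₗ D.antipode.toLinearMap ≠ 0 := fun h => by
    refine hφ.1 (LinearMap.ext fun x => ?_)
    have := LinearMap.congr_fun h (D.antipode.symm (D.antipode.symm x))
    simpa [rightIntegral] using this
  refine D.convLeft_induction _ hne (p := fun y => ∃ e, ∀ x, φ (y * x) = φ (x * e)) ⟨0, by simp⟩ ?_
    (fun d a => ?_) y
  · rintro x y ⟨e, he⟩ ⟨e', he'⟩
    exact ⟨e + e', fun z => by rw [add_mul, mul_add, map_add, map_add, he, he']⟩
  -- For `y` a slice of `(d ⊗ 1)Δ(a)` by `φ ∘ S²`, strong left invariance moves the coproduct from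
  -- `a` to `x`, strong right invariance from `x` to `S(d)`. The last two rewrites bring the
  -- functional to the form `φ(· e)`.
  · obtain ⟨e₀, he₀⟩ := hφ.exists_mul_antipode_eq hstar a
    obtain ⟨e, he⟩ := hφ.exists_rightIntegral_mul_eq hstar (D.convRight φ e₀ (D.antipode d))
    refine ⟨e, fun x => ?_⟩
    have h1 : φ (D.convLeft (D.rightIntegral φ ∘ₗ D.antipode.toLinearMap) d a * x) =
        D.rightIntegral φ (D.antipode (d * D.convRight φ x a)) := by
      rw [mul_convRight]
      change (φ ∘ₗ LinearMap.mulRight ℂ x) _ =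
        (D.rightIntegral φ ∘ₗ D.antipode.toLinearMap) _
      rw [apply_sliceRight, ← apply_sliceLeft, convLeft_apply]
    have h2 : φ (a * D.convLeft' (D.rightIntegral φ) (D.antipode d) x) =
        D.rightIntegral φ (D.convRight' φ a x * D.antipode d) := by
      rw [convRight'_mul, apply_sliceRight, ← apply_sliceLeft]
      rfl
    have h3 : φ (D.convLeft (D.rightIntegral φ) x (D.antipode d) * e₀) =
        D.rightIntegral φ (x * D.convRight φ e₀ (D.antipode d)) := by
      rw [mul_convRight, apply_sliceRight, ← apply_sliceLeft]
      rfl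
    rw [h1, hφ.antipode_antimul hstar, hφ.antipode_convRight hstar, ← h2,
      ← hφ.antipode_convLeft hstar, he₀, h3, he]

theorem IsLeftIntegral.exists_modular' (hφ : D.IsLeftIntegral φ)
    (hstar : ∀ x, φ (star x) = conj (φ x)) (e : A) : ∃ y, ∀ x, φ (x * e) = φ (star y * x) := by
  obtain ⟨y, hy⟩ := hφ.exists_modular hstar (star e)
  refine ⟨y, fun x => ?_⟩
  have h := hy (star x)
  rw [← star_mul, hstar] at h
  rw [← star_star (star y * x), hstar, star_mul, star_star, ← h, Complex.conj_conj]

/-! ### The dual -/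

theorem fourierTransform_apply (a x : A) : (fourierTransform φ a).1 x = φ (x * a) := rfl

theorem fourierTransform_fourierInv (b : DualSpace φ) :
    fourierTransform φ (fourierInv φ b) = b :=
  Subtype.ext (Classical.choose_spec b.2)

theorem IsLeftIntegral.fourierInv_fourierTransform (hφ : D.IsLeftIntegral φ)
    (hstar : ∀ x, φ (star x) = conj (φ x)) (a : A) :
    fourierInv φ (fourierTransform φ a) = a :=
  hφ.fourier_injective hstar (fourierTransform_fourierInv _)

/-- The element `φ(S⁻¹(x₍₁₎)c) x₍₂₎`. -/
noncomputable def convolution (D : MultiplierHopfStarAlgebra A) (φ : A →ₗ[ℂ] ℂ) (c : A) :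
    A →ₗ[ℂ] A :=
  sliceLeft φ ∘ₗ D.T₃.symm.toLinearMap ∘ₗ TensorProduct.mk ℂ A A c

theorem convolution_apply (c x : A) :
    D.convolution φ c x = sliceLeft φ (D.T₃.symm (c ⊗ₜ x)) := rfl

/-- Gives the default-valued choice `lam` a witness; non-degeneracy of the product makes it unique.
-/
theorem IsLeftIntegral.isConvolution (hφ : D.IsLeftIntegral φ)
    (hstar : ∀ x, φ (star x) = conj (φ x)) (c x : A) :
    D.IsConvolution φ (fourierTransform φ c) x (D.convolution φ c x) := fun d =>
  eq_of_forall_functional fun ω => by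
    rw [apply_sliceLeft, ← apply_sliceRight, convolution_apply]
    change (ω ∘ₗ LinearMap.mulRight ℂ d) _ = φ (D.antipode.symm (D.convRight ω d x) * c)
    rw [hφ.antipode_symm_convRight_mul hstar, apply_sliceLeft, ← apply_sliceRight]

theorem IsLeftIntegral.isConvolution_lam (hφ : D.IsLeftIntegral φ)
    (hstar : ∀ x, φ (star x) = conj (φ x)) (b : DualSpace φ) (x : A) :
    D.IsConvolution φ b x (D.lam φ b x) := by
  refine Classical.epsilon_spec (p := D.IsConvolution φ b x) ⟨D.convolution φ (fourierInv φ b) x, ?_⟩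
  have h := hφ.isConvolution hstar (fourierInv φ b) x
  rwa [fourierTransform_fourierInv] at h

theorem IsLeftIntegral.lam_fourierTransform (hφ : D.IsLeftIntegral φ)
    (hstar : ∀ x, φ (star x) = conj (φ x)) (c x : A) :
    D.lam φ (fourierTransform φ c) x = D.convolution φ c x :=
  D.mul_cancel_right fun d => by
    rw [hφ.isConvolution_lam hstar _ x d, hφ.isConvolution hstar c x d]

theorem IsLeftIntegral.dualMulFunctional_eq (hφ : D.IsLeftIntegral φ)
    (hstar : ∀ x, φ (star x) = conj (φ x)) (b b' : DualSpace φ) :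
    D.dualMulFunctional φ b b' =
      (fourierTransform φ (D.convolution φ (fourierInv φ b) (fourierInv φ b'))).1 := by
  ext a
  rw [fourierTransform_apply, convolution_apply, ← hφ.tensorFunctional_comul_T₃ hstar,
    LinearEquiv.apply_symm_apply]
  rfl

theorem toDual_eq {ω : A →ₗ[ℂ] ℂ} {b : DualSpace φ} (h : ω = b.1) : toDual φ ω = b := by
  subst h
  rw [toDual, dif_pos b.2]

theorem IsLeftIntegral.dualMul_fourierTransform (hφ : D.IsLeftIntegral φ)
    (hstar : ∀ x, φ (star x) = conj (φ x)) (b : DualSpace φ) (x : A) :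
    D.dualMul φ b (fourierTransform φ x) = fourierTransform φ (D.lam φ b x) := by
  have h := hφ.lam_fourierTransform hstar (fourierInv φ b) x
  rw [fourierTransform_fourierInv] at h
  rw [dualMul, toDual_eq (hφ.dualMulFunctional_eq hstar _ _), h,
    hφ.fourierInv_fourierTransform hstar]

theorem IsLeftIntegral.dualStarFunctional_mem (hφ : D.IsLeftIntegral φ)
    (hstar : ∀ x, φ (star x) = conj (φ x)) (b : DualSpace φ) :
    D.dualStarFunctional φ b ∈ DualSpace φ := by
  obtain ⟨c, rfl⟩ : ∃ c, fourierTransform φ c = b := ⟨_, fourierTransform_fourierInv b⟩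
  obtain ⟨e, he⟩ := hφ.exists_mul_antipode_eq hstar (star c)
  refine ⟨e, LinearMap.ext fun x => ?_⟩
  change φ (x * e) = conj (φ (star (D.antipode x) * c))
  rw [← he, ← hstar, star_mul, star_star]

theorem IsLeftIntegral.dualForm_fourierTransform (hφ : D.IsLeftIntegral φ)
    (hstar : ∀ x, φ (star x) = conj (φ x)) (x y : A) :
    D.dualForm φ (fourierTransform φ x) (fourierTransform φ y) = gnsForm φ x y := by
  have hs : (D.dualStar φ (fourierTransform φ x)).1 =
      D.dualStarFunctional φ (fourierTransform φ x) := by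
    rw [dualStar, toDual, dif_pos (hφ.dualStarFunctional_mem hstar _)]
  obtain ⟨c, hc⟩ : ∃ c, fourierTransform φ c = D.dualStar φ (fourierTransform φ x) :=
    ⟨_, fourierTransform_fourierInv _⟩
  rw [dualForm, hφ.dualMul_fourierTransform hstar, dualIntegral,
    hφ.fourierInv_fourierTransform hstar, ← hc, hφ.lam_fourierTransform hstar, convolution_apply,
    apply_sliceLeft, ← apply_sliceRight, ← hφ.antipode_symm_mul hstar, ← fourierTransform_apply, hc,
    hs]
  change conj (φ (star (D.antipode (D.antipode.symm y)) * x)) = φ (star x * y)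
  rw [LinearEquiv.apply_symm_apply, ← hstar, star_mul, star_star]

theorem IsLeftIntegral.dualWellDefined (hφ : D.IsLeftIntegral φ)
    (hstar : ∀ x, φ (star x) = conj (φ x)) : D.DualWellDefined φ where
  counit := D.isCounit_counit
  antipode := hφ.isAntipode_antipode hstar
  fourier_injective := hφ.fourier_injective hstar
  mul_mem b b' := by
    rw [hφ.dualMulFunctional_eq hstar]
    exact Subtype.property _
  star_mem := hφ.dualStarFunctional_mem hstar
  lam := hφ.isConvolution_lam hstar

end MultiplierHopfStarAlgebra

/-! ### The canonical map into the GNS space -/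

section GNS

variable {V : Type*} [AddCommGroup V] [Module ℂ V] {s : V → V → ℂ}

/-- The canonical map of `V` into its completion, as a linear map. -/
noncomputable def gnsLinear (hs : IsScalarProduct s) : V →ₗ[ℂ] GNS hs :=
  (UniformSpace.Completion.toComplL (𝕜 := ℂ) (E := PreGNS hs)).toLinearMap

theorem gnsLinear_apply (hs : IsScalarProduct s) (x : V) : gnsLinear hs x = gnsMap hs x := rfl

theorem denseRange_gnsLinear (hs : IsScalarProduct s) : DenseRange (gnsLinear hs) :=
  UniformSpace.Completion.denseRange_coe (α := PreGNS hs)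

theorem norm_gnsLinear_sq (hs : IsScalarProduct s) (x : V) :
    ((‖gnsLinear hs x‖ ^ 2 : ℝ) : ℂ) = s x x := by
  rw [← inner_gnsMap hs, ← gnsLinear_apply, inner_self_eq_norm_sq_to_K]
  norm_cast

theorem norm_gnsLinear_le {hs : IsScalarProduct s} {x : V} {C : ℝ} (hC : 0 ≤ C)
    (h : ∀ w, ‖s w x‖ ≤ ‖gnsLinear hs w‖ * C) : ‖gnsLinear hs x‖ ≤ C := by
  by_cases h0 : ‖gnsLinear hs x‖ = 0
  · exact h0.le.trans hC
  · have := h x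
    rw [← norm_gnsLinear_sq hs, Complex.norm_real, Real.norm_of_nonneg (sq_nonneg _), sq] at this
    exact le_of_mul_le_mul_left this (lt_of_le_of_ne (norm_nonneg _) (Ne.symm h0))

end GNS

/-! ### Norm estimates and the unitary -/

namespace MultiplierHopfStarAlgebra

open Multiplier

variable {A : Type*} [NonUnitalRing A] [Module ℂ A] [IsScalarTower ℂ A A] [SMulCommClass ℂ A A]
  [StarRing A] [StarModule ℂ A] {D : MultiplierHopfStarAlgebra A} {φ : A →ₗ[ℂ] ℂ}

theorem isScalarProduct_gnsForm (hpos : ∀ a : A, 0 ≤ φ (star a * a)) :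
    IsScalarProduct (gnsForm φ) where
  conj_symm x y := conj_symm_of_nonneg hpos x y
  nonneg := hpos
  add_left x y z := by simp [gnsForm, add_mul]
  smul_left x y r := by simp [gnsForm, smul_mul_assoc]

/-- The canonical map of `A ⊗ A` into the tensor square of the GNS space. -/
noncomputable def gnsTensor (hA : IsScalarProduct (gnsForm φ)) :
    A ⊗[ℂ] A →ₗ[ℂ] GNS hA ⊗[ℂ] GNS hA :=
  TensorProduct.map (gnsLinear hA) (gnsLinear hA)

theorem inner_gnsTensor (hA : IsScalarProduct (gnsForm φ)) (z w : A ⊗[ℂ] A) :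
    inner ℂ (gnsTensor hA z) (gnsTensor hA w) = tensorFunctional φ φ (star z * w) := by
  induction z with
  | zero => simp
  | add x y hx hy => simp only [map_add, star_add, add_mul, inner_add_left, hx, hy]
  | tmul a b =>
    induction w with
    | zero => simp
    | add x y hx hy => simp only [map_add, mul_add, inner_add_right, hx, hy]
    | tmul c d =>
      simp only [gnsTensor, TensorProduct.map_tmul, TensorProduct.inner_tmul, gnsLinear_apply,
        inner_gnsMap, gnsForm]
      simp

theorem norm_gnsTensor_tmul (hA : IsScalarProduct (gnsForm φ)) (x y : A) :
    ‖gnsTensor hA (x ⊗ₜ y)‖ = ‖gnsLinear hA x‖ * ‖gnsLinear hA y‖ := by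
  simp [gnsTensor, TensorProduct.norm_tmul]

theorem tensorFunctional_tmul_mul (a b : A) (z : A ⊗[ℂ] A) :
    tensorFunctional φ φ ((a ⊗ₜ b) * z) =
      tensorFunctional (φ ∘ₗ LinearMap.mulLeft ℂ a) (φ ∘ₗ LinearMap.mulLeft ℂ b) z := by
  induction z with
  | zero => simp
  | add x y hx hy => simp only [map_add, mul_add, hx, hy]
  | tmul x y => simp

/-- Cauchy-Schwarz in the algebraic tensor square of the GNS space. -/
theorem norm_tensorFunctional_le (hA : IsScalarProduct (gnsForm φ)) (x y : A) (z : A ⊗[ℂ] A) :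
    ‖tensorFunctional (φ ∘ₗ LinearMap.mulLeft ℂ (star x)) (φ ∘ₗ LinearMap.mulLeft ℂ (star y)) z‖ ≤
      ‖gnsLinear hA x‖ * ‖gnsLinear hA y‖ * ‖gnsTensor hA z‖ := by
  rw [← tensorFunctional_tmul_mul, ← TensorProduct.star_tmul, ← inner_gnsTensor hA,
    ← norm_gnsTensor_tmul]
  exact norm_inner_le_norm (𝕜 := ℂ) (E := GNS hA ⊗[ℂ] GNS hA) _ _

theorem IsLeftIntegral.norm_gnsTensor_T₃ (hφ : D.IsLeftIntegral φ)
    (hstar : ∀ x, φ (star x) = conj (φ x)) (hA : IsScalarProduct (gnsForm φ)) (z : A ⊗[ℂ] A) :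
    ‖gnsTensor hA (D.T₃ z)‖ = ‖gnsTensor hA z‖ := by
  have h : ∀ z w, tensorFunctional φ φ (star (D.T₃ z) * D.T₃ w) =
      tensorFunctional φ φ (star z * w) := fun z w => by
    induction z with
    | zero => simp
    | add x y hx hy => simp only [map_add, star_add, add_mul, hx, hy]
    | tmul c a =>
      -- `(Δ(a)(c ⊗ 1))⋆ = (c⋆ ⊗ 1)Δ(a⋆)`, so left invariance applies to `Δ(a⋆) T₃(w)`.
      have h1 : star (D.T₃ (c ⊗ₜ a)) * D.T₃ w =
          lmulFst (star c) (left (D.Δ (star a)) (D.T₃ w)) := D.coe_inj <| by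
        rw [D.coe_lmulFst, D.coe_comul, ← mul_assoc, ← D.T₂_spec, T₃, starConj_apply, star_star,
          TensorProduct.star_tmul]
        exact coe_left D.tensor_nondeg (coe (D.T₂ (star c ⊗ₜ star a))) _
      rw [h1, ← apply_sliceRight, sliceRight_rTensor, hφ.sliceRight_comul_T₃ hstar,
        TensorProduct.star_tmul, tensorFunctional_tmul_mul, ← apply_sliceRight]
      rfl
  have h2 := h z z
  rw [← inner_gnsTensor hA, ← inner_gnsTensor hA,
    inner_self_eq_norm_sq_to_K (𝕜 := ℂ) (E := GNS hA ⊗[ℂ] GNS hA),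
    inner_self_eq_norm_sq_to_K (𝕜 := ℂ) (E := GNS hA ⊗[ℂ] GNS hA)] at h2
  exact (sq_eq_sq₀ (norm_nonneg _) (norm_nonneg _)).mp (by exact_mod_cast h2)

variable [Nontrivial A]

/-- For `a = (ι ⊗ φ)((1 ⊗ z)Δ(v))`, the product `ax` is the slice of `T₃(x ⊗ v)` by `φ(z ·)`. As
`T₃` is isometric, `‖z⋆‖‖v‖` is a bound. -/
theorem IsLeftIntegral.exists_norm_mul_le (hφ : D.IsLeftIntegral φ)
    (hstar : ∀ x, φ (star x) = conj (φ x)) (hA : IsScalarProduct (gnsForm φ)) (a : A) :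
    ∃ C, ∀ x, ‖gnsLinear hA (a * x)‖ ≤ C * ‖gnsLinear hA x‖ := by
  refine D.convRight'_induction φ hφ.1
    (p := fun a => ∃ C, ∀ x, ‖gnsLinear hA (a * x)‖ ≤ C * ‖gnsLinear hA x‖) ⟨0, by simp⟩ ?_
    (fun z v => ?_) a
  · rintro a b ⟨C, hC⟩ ⟨C', hC'⟩
    refine ⟨C + C', fun x => ?_⟩
    rw [add_mul, map_add, add_mul]
    exact (norm_add_le _ _).trans (add_le_add (hC x) (hC' x))
  · refine ⟨‖gnsLinear hA (star z)‖ * ‖gnsLinear hA v‖, fun x =>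
      norm_gnsLinear_le (by positivity) fun w => ?_⟩
    have h := norm_tensorFunctional_le hA w (star z) (D.T₃ (x ⊗ₜ v))
    rw [hφ.norm_gnsTensor_T₃ hstar, norm_gnsTensor_tmul, star_star, ← apply_sliceRight,
      ← convRight'_mul] at h
    exact h.trans_eq (by ring)

theorem IsLeftIntegral.exists_norm_convolution_le (hφ : D.IsLeftIntegral φ)
    (hstar : ∀ x, φ (star x) = conj (φ x)) (hA : IsScalarProduct (gnsForm φ)) (c : A) :
    ∃ C, ∀ x, ‖gnsLinear hA (D.convolution φ c x)‖ ≤ C * ‖gnsLinear hA x‖ := by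
  -- On a product `c e` the factor `e` passes through `T₃⁻¹` and turns `φ` into `φ(· e) = φ(r⋆ ·)`,
  -- a functional controlled by `‖r‖`.
  obtain ⟨u, rfl⟩ := D.exists_mul'_eq c
  induction u with
  | zero => exact ⟨0, fun x => by simp [convolution_apply]⟩
  | add u v hu hv =>
    obtain ⟨C, hC⟩ := hu
    obtain ⟨C', hC'⟩ := hv
    refine ⟨C + C', fun x => ?_⟩
    rw [map_add, convolution_apply, TensorProduct.add_tmul, map_add, map_add, map_add, add_mul]
    exact (norm_add_le _ _).trans (add_le_add (hC x) (hC' x))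
  | tmul c e =>
    obtain ⟨r, hr⟩ := hφ.exists_modular' hstar e
    refine ⟨‖gnsLinear hA r‖ * ‖gnsLinear hA c‖, fun x =>
      norm_gnsLinear_le (by positivity) fun w => ?_⟩
    have h1 : D.convolution φ (c * e) x =
        sliceLeft (φ ∘ₗ LinearMap.mulLeft ℂ (star r)) (D.T₃.symm (c ⊗ₜ x)) := by
      have h2 : D.T₃.symm ((c * e) ⊗ₜ x) = rmulFst e (D.T₃.symm (c ⊗ₜ x)) := by
        rw [LinearEquiv.symm_apply_eq, T₃_rmulFst, LinearEquiv.apply_symm_apply,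
          LinearMap.rTensor_tmul, LinearMap.mulRight_apply]
      rw [convolution_apply, h2, sliceLeft_rTensor]
      congr 1
      congr 1
      exact LinearMap.ext hr
    have h := norm_tensorFunctional_le hA r w (D.T₃.symm (c ⊗ₜ x))
    rw [← hφ.norm_gnsTensor_T₃ hstar, LinearEquiv.apply_symm_apply, norm_gnsTensor_tmul,
      ← apply_sliceLeft, ← h1] at h
    exact h.trans_eq (by ring)

theorem IsLeftIntegral.isScalarProduct_dualForm (hφ : D.IsLeftIntegral φ)
    (hstar : ∀ x, φ (star x) = conj (φ x)) (hA : IsScalarProduct (gnsForm φ)) :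
    IsScalarProduct (D.dualForm φ) := by
  have h := hφ.dualForm_fourierTransform hstar
  have hF : ∀ y : DualSpace φ, ∃ x, fourierTransform φ x = y :=
    fun y => ⟨_, fourierTransform_fourierInv y⟩
  refine ⟨fun x y => ?_, fun x => ?_, fun x y z => ?_, fun x y r => ?_⟩
  · obtain ⟨x, rfl⟩ := hF x
    obtain ⟨y, rfl⟩ := hF y
    rw [h, h, hA.conj_symm]
  · obtain ⟨x, rfl⟩ := hF x
    rw [h]
    exact hA.nonneg x
  · obtain ⟨x, rfl⟩ := hF x
    obtain ⟨y, rfl⟩ := hF y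
    obtain ⟨z, rfl⟩ := hF z
    rw [← map_add, h, h, h, hA.add_left]
  · obtain ⟨x, rfl⟩ := hF x
    obtain ⟨y, rfl⟩ := hF y
    rw [← map_smul, h, h, hA.smul_left]

theorem IsLeftIntegral.exists_unitary (hφ : D.IsLeftIntegral φ)
    (hstar : ∀ x, φ (star x) = conj (φ x)) (hA : IsScalarProduct (gnsForm φ))
    (hB : IsScalarProduct (D.dualForm φ)) :
    ∃ U : GNS hA ≃ₗᵢ[ℂ] GNS hB, ∀ x, U (gnsMap hA x) = gnsMap hB (fourierTransform φ x) := by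
  let F : A ≃ₗ[ℂ] DualSpace φ := LinearEquiv.ofBijective (fourierTransform φ)
    ⟨hφ.fourier_injective hstar, fun y => ⟨_, fourierTransform_fourierInv y⟩⟩
  have hF : ∀ x, ‖gnsLinear hB (F x)‖ = ‖gnsLinear hA x‖ := fun x => by
    have h := hφ.dualForm_fourierTransform hstar x x
    rw [← norm_gnsLinear_sq hA, ← norm_gnsLinear_sq hB] at h
    exact (sq_eq_sq₀ (norm_nonneg _) (norm_nonneg _)).mp (by exact_mod_cast h)
  exact ⟨F.extendOfIsometry (gnsLinear hA) (gnsLinear hB) (denseRange_gnsLinear hA)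
    (denseRange_gnsLinear hB) hF, fun x => LinearEquiv.extendOfIsometry_eq ..⟩

end MultiplierHopfStarAlgebra

/-! ### Assembly of the operators -/

open MultiplierHopfStarAlgebra in
theorem proposition4p3 {A : Type*} [NonUnitalRing A] [Module ℂ A] [IsScalarTower ℂ A A]
    [SMulCommClass ℂ A A] [StarRing A] [StarModule ℂ A] (D : MultiplierHopfStarAlgebra A)
    (φ : A →ₗ[ℂ] ℂ) (hφ : D.IsLeftIntegral φ) (hpos : ∀ a : A, 0 ≤ φ (star a * a)) :
    D.DualWellDefined φ ∧
    ∃ (hA : IsScalarProduct (gnsForm φ)) (hB : IsScalarProduct (D.dualForm φ))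
      (U : GNS hA ≃ₗᵢ[ℂ] GNS hB)
      (piA : A → GNS hA →L[ℂ] GNS hA) (lamB : DualSpace φ → GNS hA →L[ℂ] GNS hA)
      (lamA : A → GNS hB →L[ℂ] GNS hB) (piB : DualSpace φ → GNS hB →L[ℂ] GNS hB),
      (∀ a x, piA a (gnsMap hA x) = gnsMap hA (a * x)) ∧
      (∀ b x, lamB b (gnsMap hA x) = gnsMap hA (D.lam φ b x)) ∧
      (∀ a y, lamA a (gnsMap hB y) = gnsMap hB (dualLam φ a y)) ∧
      (∀ b y, piB b (gnsMap hB y) = gnsMap hB (D.dualMul φ b y)) ∧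
      (∀ x, U (gnsMap hA x) = gnsMap hB (fourierTransform φ x)) ∧
      (∀ a ξ, U (piA a ξ) = lamA a (U ξ)) ∧
      (∀ b ξ, U (lamB b ξ) = piB b (U ξ)) := by
  have : Nontrivial A := hφ.nontrivial
  have hstar : ∀ x, φ (star x) = conj (φ x) := map_star_of_nonneg D hpos
  have hA : IsScalarProduct (gnsForm φ) := isScalarProduct_gnsForm hpos
  have hB : IsScalarProduct (D.dualForm φ) := hφ.isScalarProduct_dualForm hstar hA
  obtain ⟨U, hU⟩ := hφ.exists_unitary hstar hA hB
  have ext : ∀ f : A →ₗ[ℂ] A, (∃ C, ∀ x, ‖gnsLinear hA (f x)‖ ≤ C * ‖gnsLinear hA x‖) →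
      ∃ T : GNS hA →L[ℂ] GNS hA, ∀ x, T (gnsMap hA x) = gnsMap hA (f x) := fun f hf =>
    ⟨(gnsLinear hA ∘ₗ f).extendOfNorm (gnsLinear hA),
      LinearMap.extendOfNorm_eq (denseRange_gnsLinear hA) hf⟩
  have hpi : ∀ a : A, ∃ T : GNS hA →L[ℂ] GNS hA, ∀ x, T (gnsMap hA x) = gnsMap hA (a * x) :=
    fun a => ext (LinearMap.mulLeft ℂ a) (hφ.exists_norm_mul_le hstar hA a)
  have hlam : ∀ b : DualSpace φ, ∃ T : GNS hA →L[ℂ] GNS hA,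
      ∀ x, T (gnsMap hA x) = gnsMap hA (D.lam φ b x) := fun b => by
    obtain ⟨T, hT⟩ := ext (D.convolution φ (fourierInv φ b))
      (hφ.exists_norm_convolution_le hstar hA _)
    refine ⟨T, fun x => ?_⟩
    rw [hT, ← hφ.lam_fourierTransform hstar, fourierTransform_fourierInv]
  choose piA hpiA using hpi
  choose lamB hlamB using hlam
  have hF : ∀ y : DualSpace φ, ∃ x, fourierTransform φ x = y :=
    fun y => ⟨_, fourierTransform_fourierInv y⟩
  -- The operators on the dual side are defined as conjugates, so boundedness and intertwining are
  -- automatic; their formulas need checking only on elements `F(x)`, which exhaust the dual.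
  let conjU : (GNS hA →L[ℂ] GNS hA) → GNS hB →L[ℂ] GNS hB := fun T =>
    U.toContinuousLinearEquiv.toContinuousLinearMap ∘L T ∘L
      U.symm.toContinuousLinearEquiv.toContinuousLinearMap
  have hconj : ∀ T ξ, conjU T (U ξ) = U (T ξ) := fun T ξ => by simp [conjU]
  refine ⟨hφ.dualWellDefined hstar, hA, hB, U, piA, lamB, fun a => conjU (piA a),
    fun b => conjU (lamB b), hpiA, hlamB, fun a y => ?_, fun b y => ?_, hU,
    fun a ξ => (hconj _ _).symm, fun b ξ => (hconj _ _).symm⟩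
  · obtain ⟨x, rfl⟩ := hF y
    rw [← hU, hconj, hpiA, hU]
    congr 1
    exact Subtype.ext (LinearMap.ext fun a' => congrArg φ (mul_assoc a' a x).symm)
  · obtain ⟨x, rfl⟩ := hF y
    rw [← hU, hconj, hlamB, hU, hφ.dualMul_fourierTransform hstar]
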